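/- Let $B$ be a separable real Banach space. A sequence $(X_i,\mathcal F_i)_{i\ge1}$, where $(\mathcal F_i)_{i\ge 1}$ is a non-decreasing sequence of sub-$\sigma$-algebras on a probability space, is a ($B$-valued) martingale difference sequence if each $X_i$ is a $B$-valued, $\mathcal F_i$-measurable random variable with $\mathbb E\|X_i\|<\infty$, and $\mathbb E[X_i\mid\mathcal F_{i-1}]=0$ almost surely for every $i\ge2$. For $D>0$, the space $B$ is called $(2,D)$-smooth if (a) there is an equivalent norm $\|\cdot\|'$ on $B$ with $$\sup_{t>0}\frac1{t^2}\sup\{\|x+ty\|'+\|x-ty\|'-2:\ \|x\|'=\|y\|'=1\}<\infty,$$ and (b) $\mathbb E\big\|\sum_{i=1}^nX_i\big\|^2\le D\sum_{i=1}^n\mathbb E\|X_i\|^2$ for every $n\ge1$ and every $B$-valued martingale difference sequence $(X_i)_{i\ge 1}$ (on any probability space). **Theorem.** Let $\alpha\in(0,1)$ and $D>0$, let $B$ be a $(2,D)$-smooth separable Banach space, and let $(X_i,\mathcal F_i)_{i\ge1}$ be a $B$-valued martingale difference sequence with partial sums $S_k=\sum_{i=1}^kX_i$. Assume that for some constant $C_1$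 $$\sup_{i\ge1}\sup_{t>0}\exp\Big\{t^{\frac{2\alpha}{1-\alpha}}\Big\}\,\mathbb P(\|X_i\|>t)\le C_1 .$$ Then, for all $x>0$ and all $n\ge1$, $$\mathbb P\Big(\max_{1\le k\le n}\|S_k\|>nx\Big)\le C(\alpha,x)\exp\Big\{-\Big(\frac{x}{4D}\Big)^{2\alpha}n^\alpha\Big\},$$ where $$C(\alpha,x)=2+1007156\,e^2D^2C_1\left(\frac{1}{x^{2\alpha}\,16^{1-\alpha}D^{2(1-\alpha)}}+\frac1{x^2}\Big(\frac{3(1-\alpha)}{2\alpha}\Big)^{\frac{1-\alpha}{\alpha}}\right)$$ does not depend on $n$. In particular, as $n\to\infty$, $$\mathbb P\Big(\max_{1\le k\le n}\|S_k\|>n\Big)=O\Big(\exp\Big\{-\frac{1}{(4D)^{2\alpha}}\,n^\alpha\Big\}\Big).$$ -/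

import Mathlib

open MeasureTheory Filter Asymptotics

universe u v

/-- `(X i, ℱ i)` for `i ≥ 1` is a martingale difference sequence with values in `B`: each `X i` is
`ℱ i`-measurable and integrable, and `𝔼[X i | ℱ (i - 1)] = 0` almost surely for `i ≥ 2`.
Only the indices `i ≥ 1` matter: `X 0` is unconstrained and `ℱ 0` plays no role.
For separable `B`, strong measurability is the same as Borel measurability. -/
structure IsMartingaleDifference {Ω B : Type*} {m : MeasurableSpace Ω}
    [NormedAddCommGroup B] [NormedSpace ℝ B] [CompleteSpace B]
    (μ : Measure Ω) (ℱ : Filtration ℕ m) (X : ℕ → Ω → B) : Prop where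
  stronglyMeasurable : ∀ i : ℕ, 1 ≤ i → StronglyMeasurable[ℱ i] (X i)
  integrable : ∀ i : ℕ, 1 ≤ i → Integrable (X i) μ
  condExp_eq_zero : ∀ i : ℕ, 2 ≤ i → μ[X i | ℱ (i - 1)] =ᵐ[μ] 0

/-- The partial sum `S n = X 1 + ⋯ + X n`. -/
def partialSum {Ω B : Type*} [AddCommMonoid B] (X : ℕ → Ω → B) (n : ℕ) (ω : Ω) : B :=
  ∑ i ∈ Finset.Icc 1 n, X i ω

/-- The maximum of `‖S k‖` over `1 ≤ k ≤ n` (a supremum of a finite set of nonnegative reals). -/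
noncomputable def maxNormPartialSum {Ω B : Type*} [NormedAddCommGroup B]
    (X : ℕ → Ω → B) (n : ℕ) (ω : Ω) : ℝ :=
  ((Finset.Icc 1 n).sup fun k => ‖partialSum X k ω‖₊ : NNReal)

/-- A normed space `B` is `r`-smooth (`1 < r ≤ 2`) if it has an equivalent norm `N` such that
`N (x + t y) + N (x - t y) - 2 ≤ K t ^ r` for some constant `K`, all `t > 0` and all `x`, `y` with
`N x = N y = 1`. -/
def IsRSmooth (B : Type*) [NormedAddCommGroup B] [NormedSpace ℝ B] (r : ℝ) : Prop :=
  ∃ N : Seminorm ℝ B,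
    (∃ c C : ℝ, 0 < c ∧ 0 < C ∧ ∀ x : B, c * ‖x‖ ≤ N x ∧ N x ≤ C * ‖x‖) ∧
    ∃ K : ℝ, ∀ t : ℝ, 0 < t → ∀ x y : B, N x = 1 → N y = 1 →
      N (x + t • y) + N (x - t • y) - 2 ≤ K * t ^ r

/-- A Banach space `B` is `(r, D)`-smooth (`1 < r ≤ 2`, `0 < D`) if it is `r`-smooth and
`𝔼 ‖X 1 + ⋯ + X n‖ ^ r ≤ D * ∑ i ≤ n, 𝔼 ‖X i‖ ^ r` for all `n ≥ 1` and all `B`-valued martingale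
difference sequences `X`, on any probability space. The expectations take values in `[0, ∞]`. -/
def IsRDSmooth (B : Type u) [NormedAddCommGroup B] [NormedSpace ℝ B] [CompleteSpace B]
    (r D : ℝ) : Prop :=
  IsRSmooth B r ∧
    ∀ (Ω : Type v) (m : MeasurableSpace Ω) (μ : Measure Ω) (_ : IsProbabilityMeasure μ)
      (ℱ : Filtration ℕ m) (X : ℕ → Ω → B), IsMartingaleDifference μ ℱ X →
      ∀ n : ℕ, 1 ≤ n →
        ∫⁻ ω, ‖partialSum X n ω‖ₑ ^ r ∂μ
          ≤ ENNReal.ofReal D * ∑ i ∈ Finset.Icc 1 n, ∫⁻ ω, ‖X i ω‖ₑ ^ r ∂μ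

/-- The constant `C(α, x)`; it depends also on `D` and on the tail constant `C₁`, not on `n`. -/
noncomputable def deviationConst (D C₁ α x : ℝ) : ℝ :=
  2 + 1007156 * Real.exp 1 ^ 2 * D ^ 2 * C₁ *
    (1 / (x ^ (2 * α) * (16 : ℝ) ^ (1 - α) * D ^ (2 * (1 - α)))
      + 1 / x ^ 2 * (3 * (1 - α) / (2 * α)) ^ ((1 - α) / α))

/-! Stop the martingale once its norm exceeds `n * x`: the maximum exceeds this level only if the
final norm of the stopped martingale does, and the stopped differences keep the tail bound. Then cut
each difference at a level `w` into a truncated, recentred part and a remainder.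

The truncated part is sub-Gaussian. Tested on dyadic martingales `± d j` started at `x`, the moment
inequality says that the supremum of `𝔼 ‖x + S‖ ^ 2 - D * ∑ 𝔼 ‖d j‖ ^ 2` lies between `‖x‖ ^ 2` and
`D * ‖x‖ ^ 2`. This supremum is convex and homogeneous of degree two, so its root is a seminorm `N`;
prepending a step `± y` shows `N (x + y) ^ 2 + N (x - y) ^ 2 ≤ 2 * N x ^ 2 + 2 * D * ‖y‖ ^ 2`
(`exists_smooth_seminorm`). Through the power series this becomes an inequality for `cosh ∘ N`
(`cosh_add_cosh_le`), so that `𝔼 cosh (l * N S)` grows by a factor at most `exp (2 * D * l ^ 2 * w ^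
2)` per step (`integral_cosh_add_sub_condExp_le`), and Markov's inequality applies.

The remainder is treated by Chebyshev and the moment inequality; its second moments are of order
`exp (-w ^ p)`, `p = 2 * α / (1 - α)`, up to a factor polynomial in `w`
(`lintegral_sq_indicator_le`). The exponents `n * x ^ 2 / (16 * D ^ 2 * w ^ 2)` and `w ^ p` agree
for `w = (√n * x / (4 * D)) ^ (1 - α)`, and their common value is `(x / (4 * D)) ^ (2 * α) * n ^ α`.
-/

section DyadicValue

/-! ### Values of dyadic martingales. -/

variable {B : Type*} [NormedAddCommGroup B]

/-- The real numbers `𝔼 ‖x + S‖ ^ 2 - D * ∑ 𝔼 ‖d j‖ ^ 2`, where `S` is the final value of a dyadic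
martingale of length `k` with differences `± d j`. -/
def DyadicValue (D : ℝ) : ℕ → B → ℝ → Prop
  | 0, x, r => r = ‖x‖ ^ 2
  | k + 1, x, r => ∃ (y : B) (a b : ℝ), DyadicValue D k (x + y) a ∧ DyadicValue D k (x - y) b ∧
      r = (a + b) / 2 - D * ‖y‖ ^ 2

theorem DyadicValue.succ {D : ℝ} {k : ℕ} {x : B} {r : ℝ} (h : DyadicValue D k x r) :
    DyadicValue D (k + 1) x r :=
  ⟨0, r, r, by simpa using h, by simpa using h, by simp⟩

/-- Zero steps pad a martingale, so two martingales can be given a common length before they are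
joined by a first step. -/
theorem DyadicValue.mono {D : ℝ} {k l : ℕ} (hkl : k ≤ l) {x : B} {r : ℝ}
    (h : DyadicValue D k x r) : DyadicValue D l x r := by
  induction hkl with
  | refl => exact h
  | step _ ih => exact ih.succ

variable [NormedSpace ℝ B]

theorem DyadicValue.smul {D : ℝ} (c : ℝ) {k : ℕ} : ∀ {x : B} {r : ℝ}, DyadicValue D k x r →
    DyadicValue D k (c • x) (c ^ 2 * r) := by
  induction k with
  | zero =>
    intro x r h
    simp only [DyadicValue] at h ⊢
    rw [h, norm_smul, mul_pow, Real.norm_eq_abs, sq_abs]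
  | succ k ih =>
    rintro x r ⟨y, a, b, ha, hb, rfl⟩
    refine ⟨c • y, c ^ 2 * a, c ^ 2 * b, by simpa using ih ha, by simpa [smul_sub] using ih hb, ?_⟩
    rw [norm_smul, mul_pow, Real.norm_eq_abs, sq_abs]
    ring

/-- Run the same differences from `x` and from `z`: the penalty terms coincide, and at the leaves
`‖·‖ ^ 2` is convex. -/
theorem DyadicValue.convex {D : ℝ} {s t : ℝ} (hs : 0 ≤ s) (ht : 0 ≤ t) (hst : s + t = 1) {k : ℕ} :
    ∀ {x z : B} {r : ℝ}, DyadicValue D k (s • x + t • z) r →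
      ∃ a b, DyadicValue D k x a ∧ DyadicValue D k z b ∧ r ≤ s * a + t * b := by
  induction k with
  | zero =>
    intro x z r h
    refine ⟨_, _, rfl, rfl, ?_⟩
    have h1 : ‖s • x + t • z‖ ≤ s * ‖x‖ + t * ‖z‖ := by
      refine (norm_add_le _ _).trans_eq ?_
      rw [norm_smul, norm_smul, Real.norm_of_nonneg hs, Real.norm_of_nonneg ht]
    have h2 : r = ‖s • x + t • z‖ ^ 2 := h
    have h3 := pow_le_pow_left₀ (norm_nonneg _) h1 2
    have h4 : s = 1 - t := by linarith
    rw [h2]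
    refine h3.trans ?_
    nlinarith [mul_nonneg (mul_nonneg hs ht) (sq_nonneg (‖x‖ - ‖z‖))]
  | succ k ih =>
    rintro x z r ⟨y, a, b, ha, hb, rfl⟩
    have e1 : s • x + t • z + y = s • (x + y) + t • (z + y) := by
      have : y = (s + t) • y := by rw [hst, one_smul]
      conv_lhs => rw [this]
      module
    have e2 : s • x + t • z - y = s • (x - y) + t • (z - y) := by
      have : y = (s + t) • y := by rw [hst, one_smul]
      conv_lhs => rw [this]
      module
    rw [e1] at ha
    rw [e2] at hb
    obtain ⟨a₁, a₂, h1, h2, h3⟩ := ih ha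
    obtain ⟨b₁, b₂, k1, k2, k3⟩ := ih hb
    refine ⟨_, _, ⟨y, a₁, b₁, h1, k1, rfl⟩, ⟨y, a₂, b₂, h2, k2, rfl⟩, ?_⟩
    have : D * ‖y‖ ^ 2 = s * (D * ‖y‖ ^ 2) + t * (D * ‖y‖ ^ 2) := by rw [← add_mul, hst, one_mul]
    linarith

/-- The sign `±1` of a coin toss. -/
def coinSign (b : Bool) : ℝ := if b then 1 else -1

theorem abs_coinSign (b : Bool) : |coinSign b| = 1 := by cases b <;> simp [coinSign]

theorem coinSign_not (b : Bool) : coinSign (!b) = -coinSign b := by cases b <;> simp [coinSign]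

theorem sum_fin_succ_bool {k : ℕ} (f : (Fin (k + 1) → Bool) → ℝ) :
    ∑ ω, f ω = ∑ ω, f (Fin.cons true ω) + ∑ ω, f (Fin.cons false ω) := by
  rw [← (Fin.consEquiv fun _ => Bool).sum_comp, Fintype.sum_prod_type]
  simp [Fin.consEquiv]

/-- Unrolls the recursion into predictable differences on the cube of sign sequences: the step at
each node depends only on the earlier tosses. -/
theorem DyadicValue.exists_differences {D : ℝ} {k : ℕ} : ∀ {x : B} {r : ℝ}, DyadicValue D k x r →
    ∃ d : Fin k → (Fin k → Bool) → B,
      (∀ j ω ω', (∀ i < j, ω i = ω' i) → d j ω = d j ω') ∧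
      2 ^ k * r =
        ∑ ω, (‖x + ∑ j, coinSign (ω j) • d j ω‖ ^ 2 - D * ∑ j, ‖d j ω‖ ^ 2) := by
  induction k with
  | zero =>
    intro x r h
    refine ⟨fun _ _ => 0, fun j => j.elim0, ?_⟩
    have h : r = ‖x‖ ^ 2 := h
    simp [h]
  | succ k ih =>
    rintro x r ⟨y, a, b, ha, hb, rfl⟩
    obtain ⟨d₁, h₁, e₁⟩ := ih ha
    obtain ⟨d₂, h₂, e₂⟩ := ih hb
    refine ⟨fun j ω => Fin.cases y
      (fun j => if ω 0 then d₁ j (Fin.tail ω) else d₂ j (Fin.tail ω)) j, ?_, ?_⟩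
    · intro j ω ω' h
      refine Fin.cases ?_ (fun j h => ?_) j h
      · intro _; rfl
      · simp only [Fin.cases_succ]
        rw [h 0 (Fin.succ_pos j), h₁ j (Fin.tail ω) (Fin.tail ω') fun i hi =>
          h i.succ (Fin.succ_lt_succ_iff.2 hi), h₂ j (Fin.tail ω) (Fin.tail ω') fun i hi =>
          h i.succ (Fin.succ_lt_succ_iff.2 hi)]
    · rw [sum_fin_succ_bool]
      simp only [Fin.sum_univ_succ, Fin.cons_zero, Fin.cons_succ, Fin.cases_zero, Fin.cases_succ,
        Fin.tail_cons, if_true, coinSign, Bool.false_eq_true, if_false]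
      have e₁' : 2 ^ k * a - 2 ^ k * (D * ‖y‖ ^ 2) = _ := congrArg (· - 2 ^ k * (D * ‖y‖ ^ 2)) e₁
      have e₂' : 2 ^ k * b - 2 ^ k * (D * ‖y‖ ^ 2) = _ := congrArg (· - 2 ^ k * (D * ‖y‖ ^ 2)) e₂
      have hc : (2 : ℝ) ^ k * (D * ‖y‖ ^ 2) = ∑ _ω : Fin k → Bool, D * ‖y‖ ^ 2 := by simp
      calc 2 ^ (k + 1) * ((a + b) / 2 - D * ‖y‖ ^ 2)
          = (2 ^ k * a - 2 ^ k * (D * ‖y‖ ^ 2)) + (2 ^ k * b - 2 ^ k * (D * ‖y‖ ^ 2)) := by ring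
        _ = _ := by
          rw [e₁', e₂', hc, ← Finset.sum_sub_distrib, ← Finset.sum_sub_distrib]
          congr 1 <;> refine Finset.sum_congr rfl fun ω _ => ?_
          · rw [one_smul, ← add_assoc]; simp only [coinSign]; ring
          · rw [neg_one_smul, ← add_assoc, ← sub_eq_add_neg]; simp only [coinSign]; ring

end DyadicValue

/-! ### Dyadic martingales as martingale difference sequences. -/

section CoinMartingale

/-- The events that depend only on the coin tosses `j` with `j + 1 < i`. -/
def coinFiltration (k : ℕ) : @Filtration (ULift.{v} (Fin k → Bool)) ℕ _ ⊤ where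
  seq i :=
    { MeasurableSet' := fun A => ∀ ω ω' : ULift (Fin k → Bool),
        (∀ j : Fin k, (j : ℕ) + 1 < i → ω.down j = ω'.down j) → (ω ∈ A ↔ ω' ∈ A)
      measurableSet_empty := fun _ _ _ => Iff.rfl
      measurableSet_compl := fun A hA ω ω' h => not_congr (hA ω ω' h)
      measurableSet_iUnion := fun f hf ω ω' h => by
        simp only [Set.mem_iUnion]
        exact exists_congr fun i => hf i ω ω' h }
  mono' := fun _ _ hij A hA ω ω' h => hA ω ω' fun j hj => h j (hj.trans_le hij)
  le' := fun _ _ _ => trivial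

/-- Independent fair coin tosses. -/
noncomputable def coinMeasure (k : ℕ) : @Measure (ULift.{v} (Fin k → Bool)) ⊤ :=
  letI : MeasurableSpace (ULift.{v} (Fin k → Bool)) := ⊤
  (2 ^ k : ENNReal)⁻¹ • Measure.count

theorem isProbabilityMeasure_coinMeasure (k : ℕ) :
    @IsProbabilityMeasure _ ⊤ (coinMeasure.{v} k) := by
  let : MeasurableSpace (ULift.{v} (Fin k → Bool)) := ⊤
  constructor
  simp only [coinMeasure, Measure.smul_apply, smul_eq_mul]
  rw [Measure.count_apply_finite _ Set.finite_univ]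
  simp
  rw [ENNReal.inv_mul_cancel] <;> simp

theorem lintegral_coinMeasure (k : ℕ) (f : ULift.{v} (Fin k → Bool) → ENNReal) :
    @lintegral _ ⊤ (coinMeasure.{v} k) f = (2 ^ k : ENNReal)⁻¹ * ∑ ω : Fin k → Bool, f ⟨ω⟩ := by
  let : MeasurableSpace (ULift.{v} (Fin k → Bool)) := ⊤
  simp only [coinMeasure, lintegral_smul_measure, smul_eq_mul]
  rw [lintegral_count, tsum_fintype, ← Equiv.ulift.symm.sum_comp]
  rfl

variable {B : Type*} [NormedAddCommGroup B] [NormedSpace ℝ B]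

theorem integral_coinMeasure [CompleteSpace B] (k : ℕ) (f : ULift.{v} (Fin k → Bool) → B) :
    @integral _ _ _ _ ⊤ (coinMeasure.{v} k) f = (2 ^ k : ℝ)⁻¹ • ∑ ω : Fin k → Bool, f ⟨ω⟩ := by
  let : MeasurableSpace (ULift.{v} (Fin k → Bool)) := ⊤
  have : MeasurableSingletonClass (ULift.{v} (Fin k → Bool)) := ⟨fun _ => trivial⟩
  simp only [coinMeasure, integral_smul_measure]
  rw [integral_count, ← Equiv.ulift.symm.sum_comp]
  simp

theorem measurable_coinFiltration {k i : ℕ} {β : Type*} [MeasurableSpace β]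
    {f : ULift.{v} (Fin k → Bool) → β}
    (hf : ∀ ω ω', (∀ j : Fin k, (j : ℕ) + 1 < i → ω.down j = ω'.down j) → f ω = f ω') :
    Measurable[coinFiltration.{v} k i] f := fun A _ ω ω' h => by
  simp only [Set.mem_preimage, hf ω ω' h]

/-- The martingale differences `x, ± d 0, …, ± d (k - 1), 0, …`, indexed from `1`. -/
def coinDifference {k : ℕ} (x : B) (d : Fin k → (Fin k → Bool) → B) :
    ℕ → ULift.{v} (Fin k → Bool) → B
  | 0, _ => 0
  | 1, _ => x
  | i + 2, ω => if h : i < k then coinSign (ω.down ⟨i, h⟩) • d ⟨i, h⟩ ω.down else 0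

theorem partialSum_coinDifference {k : ℕ} (x : B) (d : Fin k → (Fin k → Bool) → B)
    (ω : ULift.{v} (Fin k → Bool)) :
    partialSum (coinDifference x d) (k + 1) ω =
      x + ∑ j, coinSign (ω.down j) • d j ω.down := by
  have : Finset.Icc 1 (k + 1) = Finset.Ico 1 (k + 2) := by ext; simp; omega
  rw [partialSum, this, Finset.sum_Ico_eq_sum_range, show k + 2 - 1 = k + 1 from rfl,
    Finset.sum_range_succ', add_comm, Finset.sum_range]
  refine congrArg₂ _ rfl (Finset.sum_congr rfl fun j _ => ?_)
  rw [show 1 + ((j : ℕ) + 1) = j + 2 by ring]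
  simp [coinDifference]

theorem isMartingaleDifference_coinDifference [CompleteSpace B]
    [TopologicalSpace.SeparableSpace B] {k : ℕ} (x : B)
    {d : Fin k → (Fin k → Bool) → B}
    (hd : ∀ j ω ω', (∀ i < j, ω i = ω' i) → d j ω = d j ω') :
    @IsMartingaleDifference _ B ⊤ _ _ _ (coinMeasure.{v} k) (coinFiltration k)
      (coinDifference x d) := by
  let : MeasurableSpace (ULift.{v} (Fin k → Bool)) := ⊤
  have := isProbabilityMeasure_coinMeasure.{v} k
  have : MeasurableSingletonClass (ULift.{v} (Fin k → Bool)) := ⟨fun _ => trivial⟩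
  have : SecondCountableTopology B := UniformSpace.secondCountable_of_separable B
  borelize B
  have hint : ∀ f : ULift.{v} (Fin k → Bool) → B, Integrable f (coinMeasure.{v} k) :=
    fun f => Integrable.of_finite
  refine ⟨fun i hi => ?_, fun i _ => hint _, fun i hi => ?_⟩
  · refine Measurable.stronglyMeasurable (measurable_coinFiltration fun ω ω' h => ?_)
    match i, hi with
    | 1, _ => rfl
    | i + 2, _ =>
      simp only [coinDifference]
      split_ifs with hik
      · rw [h ⟨i, hik⟩ (Nat.lt_succ_self _), hd ⟨i, hik⟩ ω.down ω'.down fun j hj => h j ?_]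
        have : (j : ℕ) < i := hj
        omega
      · rfl
  · obtain ⟨i, rfl⟩ : ∃ l, i = l + 2 := ⟨i - 2, by omega⟩
    refine (ae_eq_condExp_of_forall_setIntegral_eq ((coinFiltration.{v} k).le _) (hint _)
      (fun _ _ _ => integrableOn_zero) (fun A hA _ => ?_)
      stronglyMeasurable_zero.aestronglyMeasurable).symm
    simp only [integral_zero]
    rw [← integral_indicator (show MeasurableSet A from trivial), integral_coinMeasure]
    by_cases hik : i < k
    swap
    · simp [coinDifference, hik, Set.indicator]
    -- Flipping toss `i` preserves counting measure and every event of index `i + 1`, which sees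
    -- only tosses before `i`, and reverses the sign of the difference. Hence its integral over such
    -- an event equals its own negative.
    let flip : (Fin k → Bool) → (Fin k → Bool) := fun ω =>
      Function.update ω ⟨i, hik⟩ (!(ω ⟨i, hik⟩))
    have hflip : Function.Involutive flip := fun ω => by simp [flip]
    have key : ∀ ω : Fin k → Bool,
        A.indicator (coinDifference.{v} x d (i + 2)) ⟨flip ω⟩ =
          -A.indicator (coinDifference.{v} x d (i + 2)) ⟨ω⟩ := by
      intro ω
      have hagree : ∀ j : Fin k, (j : ℕ) < i → flip ω j = ω j := fun j hj => by
        have : j ≠ ⟨i, hik⟩ := fun h => by simp [h] at hj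
        simp [flip, this]
      have hmem : (⟨flip ω⟩ : ULift.{v} (Fin k → Bool)) ∈ A ↔ ⟨ω⟩ ∈ A :=
        hA _ _ fun j hj => hagree j (by simpa using hj)
      by_cases hω : (⟨ω⟩ : ULift.{v} (Fin k → Bool)) ∈ A
      · rw [Set.indicator_of_mem hω, Set.indicator_of_mem (hmem.2 hω)]
        simp only [coinDifference, hik, dif_pos]
        rw [hd ⟨i, hik⟩ (flip ω) ω fun j hj => hagree j hj, ← neg_smul, ← coinSign_not]
        simp [flip]
      · rw [Set.indicator_of_notMem hω, Set.indicator_of_notMem (hmem.not.2 hω), neg_zero]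
    have hsum : ∑ ω : Fin k → Bool, A.indicator (coinDifference.{v} x d (i + 2)) ⟨ω⟩ =
        -∑ ω : Fin k → Bool, A.indicator (coinDifference.{v} x d (i + 2)) ⟨ω⟩ := by
      rw [← Finset.sum_neg_distrib, ← Equiv.sum_comp hflip.toPerm]
      exact Finset.sum_congr rfl fun ω _ => key ω
    have h2 := congrArg (· + ∑ ω, A.indicator (coinDifference.{v} x d (i + 2)) ⟨ω⟩) hsum
    simp only [neg_add_cancel, ← two_smul ℝ, smul_eq_zero, two_ne_zero, false_or] at h2
    rw [h2, smul_zero]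

end CoinMartingale

/-- The moment inequality in the definition of `(2, D)`-smoothness, for dyadic martingales. -/
theorem IsRDSmooth.dyadicValue_le {B : Type u} [NormedAddCommGroup B] [NormedSpace ℝ B]
    [CompleteSpace B] [TopologicalSpace.SeparableSpace B] {D : ℝ} (hD : 0 < D)
    (hB : IsRDSmooth.{u, v} B 2 D) {k : ℕ} {x : B} {r : ℝ} (h : DyadicValue D k x r) :
    r ≤ D * ‖x‖ ^ 2 := by
  obtain ⟨d, hd, e⟩ := h.exists_differences
  -- The starting point is counted as the first difference, which need not be centred; hence length
  -- `k + 1` and the term `D * ‖x‖ ^ 2`. The coin space is lifted to the universe over which `hB`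
  -- quantifies.
  have h1 := hB.2 _ ⊤ (coinMeasure.{v} k) (isProbabilityMeasure_coinMeasure k) _ _
    (isMartingaleDifference_coinDifference x hd) (k + 1) (by omega)
  have hpow : ∀ z : B, ‖z‖ₑ ^ (2 : ℝ) = ENNReal.ofReal (‖z‖ ^ 2) := fun z => by
    rw [← ofReal_norm, ENNReal.ofReal_rpow_of_nonneg (norm_nonneg _) (by norm_num)]
    norm_num
  simp only [lintegral_coinMeasure, partialSum_coinDifference, hpow] at h1
  have h2 : ∑ i ∈ Finset.Icc 1 (k + 1), ∑ ω : Fin k → Bool,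
      ENNReal.ofReal (‖coinDifference.{v} x d i ⟨ω⟩‖ ^ 2) =
      ENNReal.ofReal (2 ^ k * ‖x‖ ^ 2 + ∑ ω, ∑ j, ‖d j ω‖ ^ 2) := by
    have : Finset.Icc 1 (k + 1) = Finset.Ico 1 (k + 2) := by ext; simp; omega
    have hcomm : ∑ ω, ∑ j, ‖d j ω‖ ^ 2 = ∑ j, ∑ ω, ‖d j ω‖ ^ 2 := Finset.sum_comm
    rw [this, Finset.sum_Ico_eq_sum_range, show k + 2 - 1 = k + 1 from rfl,
      Finset.sum_range_succ', add_comm, Finset.sum_range, ENNReal.ofReal_add (by positivity)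
      (by positivity), hcomm,
      ENNReal.ofReal_sum_of_nonneg fun _ _ => by positivity]
    congr 1
    · simp [coinDifference, ENNReal.ofReal_mul]
    · refine Finset.sum_congr rfl fun j _ => ?_
      rw [ENNReal.ofReal_sum_of_nonneg fun _ _ => by positivity]
      refine Finset.sum_congr rfl fun ω _ => ?_
      rw [show 1 + ((j : ℕ) + 1) = j + 2 by ring]
      simp only [coinDifference, Fin.is_lt, dif_pos, Fin.eta, norm_smul, Real.norm_eq_abs,
        abs_coinSign, one_mul]
  rw [← Finset.mul_sum, h2, mul_left_comm, ← ENNReal.ofReal_sum_of_nonneg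
    fun _ _ => by positivity, ← ENNReal.ofReal_mul hD.le,
    ENNReal.mul_le_mul_iff_right (by simp) (by simp),
    ENNReal.ofReal_le_ofReal_iff (by positivity)] at h1
  rw [Finset.sum_sub_distrib, ← Finset.mul_sum] at e
  have h3 : (2 : ℝ) ^ k * r ≤ 2 ^ k * (D * ‖x‖ ^ 2) := by rw [e]; linarith
  exact le_of_mul_le_mul_left h3 (by positivity)

/-! ### Renorming by a 2-smooth seminorm. -/

section SmoothSeminorm

variable {B : Type*} [NormedAddCommGroup B]

/-- The supremum of the values of all dyadic martingales started at `x`. -/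
noncomputable def dyadicSup (D : ℝ) (x : B) : ℝ :=
  sSup {r | ∃ k, DyadicValue D k x r}

theorem DyadicValue.le_dyadicSup {D : ℝ}
    (hbound : ∀ (k : ℕ) (x : B) (r : ℝ), DyadicValue D k x r → r ≤ D * ‖x‖ ^ 2)
    {k : ℕ} {x : B} {r : ℝ} (h : DyadicValue D k x r) :
    r ≤ dyadicSup D x :=
  le_csSup ⟨D * ‖x‖ ^ 2, fun _ ⟨k, hk⟩ => hbound k x _ hk⟩ ⟨k, h⟩

theorem dyadicSup_le {D : ℝ} {x : B} {c : ℝ} (h : ∀ k r, DyadicValue D k x r → r ≤ c) :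
    dyadicSup D x ≤ c :=
  csSup_le ⟨_, 0, rfl⟩ fun _ ⟨k, hk⟩ => h k _ hk

theorem sq_norm_le_dyadicSup {D : ℝ}
    (hbound : ∀ (k : ℕ) (x : B) (r : ℝ), DyadicValue D k x r → r ≤ D * ‖x‖ ^ 2) (x : B) :
    ‖x‖ ^ 2 ≤ dyadicSup D x :=
  DyadicValue.le_dyadicSup hbound (k := 0) rfl

/-- Near-optimal martingales from `x + y` and `x - y`, preceded by the step `± y`, form one
competitor started at `x`. -/
theorem dyadicSup_add_add_dyadicSup_sub_le {D : ℝ}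
    (hbound : ∀ (k : ℕ) (x : B) (r : ℝ), DyadicValue D k x r → r ≤ D * ‖x‖ ^ 2) (x y : B) :
    dyadicSup D (x + y) + dyadicSup D (x - y) ≤ 2 * dyadicSup D x + 2 * (D * ‖y‖ ^ 2) := by
  refine le_sub_iff_add_le.1 (dyadicSup_le fun k a ha => le_sub_comm.1 (dyadicSup_le
    fun l b hb => ?_))
  have := DyadicValue.le_dyadicSup hbound (k := max k l + 1) (x := x)
    ⟨y, a, b, ha.mono (le_max_left k l), hb.mono (le_max_right k l), rfl⟩
  linarith

variable [NormedSpace ℝ B]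

theorem dyadicSup_convex {D : ℝ}
    (hbound : ∀ (k : ℕ) (x : B) (r : ℝ), DyadicValue D k x r → r ≤ D * ‖x‖ ^ 2) {s t : ℝ}
    (hs : 0 ≤ s) (ht : 0 ≤ t) (hst : s + t = 1) (x z : B) :
    dyadicSup D (s • x + t • z) ≤ s * dyadicSup D x + t * dyadicSup D z := by
  refine dyadicSup_le fun k r hr => ?_
  obtain ⟨a, b, ha, hb, h⟩ := hr.convex hs ht hst
  have h1 := mul_le_mul_of_nonneg_left (ha.le_dyadicSup hbound) hs
  have h2 := mul_le_mul_of_nonneg_left (hb.le_dyadicSup hbound) ht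
  linarith

theorem dyadicSup_smul {D : ℝ}
    (hbound : ∀ (k : ℕ) (x : B) (r : ℝ), DyadicValue D k x r → r ≤ D * ‖x‖ ^ 2) (c : ℝ) (x : B) :
    dyadicSup D (c • x) = c ^ 2 * dyadicSup D x := by
  have key : ∀ (c : ℝ) (x : B), c ≠ 0 → c ^ 2 * dyadicSup D x ≤ dyadicSup D (c • x) := by
    intro c x hc
    rw [mul_comm, ← le_div_iff₀ (by positivity)]
    refine dyadicSup_le fun k r hr => ?_
    rw [le_div_iff₀ (by positivity), mul_comm]
    exact (hr.smul c).le_dyadicSup hbound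
  rcases eq_or_ne c 0 with rfl | hc
  · have h1 := sq_norm_le_dyadicSup hbound (0 : B)
    have h2 : dyadicSup D (0 : B) ≤ 0 :=
      dyadicSup_le fun k r hr => by simpa using hbound k 0 r hr
    simp only [norm_zero] at h1
    simp only [zero_smul]
    linarith
  · refine le_antisymm ?_ (key c x hc)
    have h := key c⁻¹ (c • x) (inv_ne_zero hc)
    rwa [inv_smul_smul₀ hc, inv_pow, inv_mul_le_iff₀ (by positivity)] at h

/-- The seminorm is the root of `dyadicSup`. Only one of the two directions is measured by `N`; the
increment `y` keeps the original norm, as the truncation bounds require. -/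
theorem exists_smooth_seminorm {D : ℝ}
    (hbound : ∀ (k : ℕ) (x : B) (r : ℝ), DyadicValue D k x r → r ≤ D * ‖x‖ ^ 2) :
    ∃ N : Seminorm ℝ B, (∀ x, ‖x‖ ≤ N x) ∧ (∀ x, N x ≤ √D * ‖x‖) ∧
      ∀ x y, N (x + y) ^ 2 + N (x - y) ^ 2 ≤ 2 * N x ^ 2 + 2 * (√D * ‖y‖) ^ 2 := by
  have h0 : ∀ x : B, 0 ≤ dyadicSup D x := fun x =>
    (sq_nonneg _).trans (sq_norm_le_dyadicSup hbound x)
  have hsmul : ∀ (c : ℝ) (x : B), √(dyadicSup D (c • x)) = ‖c‖ * √(dyadicSup D x) := fun c x => by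
    rw [dyadicSup_smul hbound, Real.sqrt_mul (sq_nonneg c), Real.sqrt_sq_eq_abs, Real.norm_eq_abs]
  have hle : ∀ x : B, ‖x‖ ≤ √(dyadicSup D x) := fun x =>
    Real.le_sqrt_of_sq_le (sq_norm_le_dyadicSup hbound x)
  have hD : ∀ x : B, dyadicSup D x ≤ D * ‖x‖ ^ 2 := fun x => dyadicSup_le fun k r => hbound k x r
  have hadd : ∀ x y : B, √(dyadicSup D (x + y)) ≤ √(dyadicSup D x) + √(dyadicSup D y) := by
    intro x y
    rcases eq_or_ne x 0 with rfl | hx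
    · simp
    rcases eq_or_ne y 0 with rfl | hy
    · simp
    have ha : 0 < √(dyadicSup D x) := (norm_pos_iff.2 hx).trans_le (hle x)
    have hb : 0 < √(dyadicSup D y) := (norm_pos_iff.2 hy).trans_le (hle y)
    set a := √(dyadicSup D x) with ha'
    set b := √(dyadicSup D y) with hb'
    have hxa : dyadicSup D x = a ^ 2 := (Real.sq_sqrt (h0 x)).symm
    have hyb : dyadicSup D y = b ^ 2 := (Real.sq_sqrt (h0 y)).symm
    -- Triangle inequality from convexity: `(a + b)⁻¹ • (x + y)` is a convex combination of the
    -- normalized vectors `a⁻¹ • x` and `b⁻¹ • y`, where `dyadicSup` is one.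
    have h := dyadicSup_convex hbound (s := a / (a + b)) (t := b / (a + b)) (by positivity)
      (by positivity) (by field_simp) (a⁻¹ • x) (b⁻¹ • y)
    rw [dyadicSup_smul hbound, dyadicSup_smul hbound, hxa, hyb, smul_smul, smul_smul,
      show a / (a + b) * a⁻¹ = (a + b)⁻¹ by field_simp,
      show b / (a + b) * b⁻¹ = (a + b)⁻¹ by field_simp, ← smul_add, dyadicSup_smul hbound,
      show a / (a + b) * (a⁻¹ ^ 2 * a ^ 2) + b / (a + b) * (b⁻¹ ^ 2 * b ^ 2) = 1 by field_simp,
      inv_pow, inv_mul_le_iff₀ (by positivity), mul_one] at h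
    exact Real.sqrt_le_iff.2 ⟨by positivity, h⟩
  refine ⟨Seminorm.of (fun x => √(dyadicSup D x)) hadd hsmul, hle, fun x => ?_, fun x y => ?_⟩
  · show √(dyadicSup D x) ≤ _
    refine (Real.sqrt_le_sqrt (hD x)).trans_eq ?_
    rw [Real.sqrt_mul' _ (sq_nonneg _), Real.sqrt_sq (norm_nonneg _)]
  · show √(dyadicSup D (x + y)) ^ 2 + √(dyadicSup D (x - y)) ^ 2 ≤
      2 * √(dyadicSup D x) ^ 2 + 2 * (√D * ‖y‖) ^ 2
    have hDy : D * ‖y‖ ^ 2 ≤ (√D * ‖y‖) ^ 2 := by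
      rw [mul_pow]
      rcases le_total 0 D with h | h
      · rw [Real.sq_sqrt h]
      · exact (mul_nonpos_of_nonpos_of_nonneg h (sq_nonneg _)).trans (by positivity)
    rw [Real.sq_sqrt (h0 _), Real.sq_sqrt (h0 _), Real.sq_sqrt (h0 _)]
    linarith [dyadicSup_add_add_dyadicSup_sub_le hbound x y]

end SmoothSeminorm

/-! ### Scalar inequalities for the hyperbolic cosine. -/

section HyperbolicCosine

/-- Weak majorization for the increasing convex function `t ^ n`: in the main case raise `b` to `c +
d - a`; then the pair lies between `d` and `c` with the same sum. -/
theorem pow_add_pow_le_of_le_of_add_le {a b c d : ℝ} (ha : 0 ≤ a) (hb : 0 ≤ b) (hd : 0 ≤ d)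
    (hac : a ≤ c) (hbc : b ≤ c) (h : a + b ≤ c + d) (n : ℕ) :
    a ^ n + b ^ n ≤ c ^ n + d ^ n := by
  wlog hab : b ≤ a generalizing a b
  · rw [add_comm]
    exact this hb ha hbc hac (by linarith) (by linarith)
  rcases lt_or_ge a d with had | had
  · exact add_le_add (pow_le_pow_left₀ ha hac n) (pow_le_pow_left₀ hb (hab.trans had.le) n)
  · have hb' : b ≤ c + d - a := by linarith
    refine (add_le_add_right (pow_le_pow_left₀ hb hb' n) _).trans ?_
    rcases eq_or_lt_of_le (had.trans hac) with hcd | hcd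
    · have : a = c := le_antisymm hac (hcd ▸ had)
      simp [this]
    have hs : 0 < c - d := sub_pos.2 hcd
    have hconv := (convexOn_pow n : ConvexOn ℝ (Set.Ici 0) fun x : ℝ => x ^ n)
    have hc : c ∈ Set.Ici (0 : ℝ) := hd.trans hcd.le
    have p1 : 0 ≤ (a - d) / (c - d) := by apply div_nonneg <;> linarith
    have p2 : 0 ≤ (c - a) / (c - d) := by apply div_nonneg <;> linarith
    have p3 : (a - d) / (c - d) + (c - a) / (c - d) = 1 := by field_simp; ring
    have h1 := hconv.2 hc (Set.mem_Ici.2 hd) p1 p2 p3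
    have h2 := hconv.2 hc (Set.mem_Ici.2 hd) p2 p1 (by linarith)
    simp only [smul_eq_mul] at h1 h2
    rw [show (a - d) / (c - d) * c + (c - a) / (c - d) * d = a by field_simp; ring] at h1
    rw [show (c - a) / (c - d) * c + (a - d) / (c - d) * d = c + d - a by field_simp; ring] at h2
    have h3 : (a - d) / (c - d) = 1 - (c - a) / (c - d) := by linarith
    rw [h3] at h1 h2
    linarith

/-- The right side is `cosh (n + δ) + cosh (n - δ)`. Since `cosh` is a power series in the square
with nonnegative coefficients, it suffices to compare powers of `a ^ 2`, `b ^ 2` with those of `(n +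
δ) ^ 2`, `(n - δ) ^ 2`. -/
theorem cosh_add_cosh_le {a b n δ : ℝ} (ha : 0 ≤ a) (hb : 0 ≤ b)
    (han : a ≤ n + δ) (hbn : b ≤ n + δ) (h : a ^ 2 + b ^ 2 ≤ 2 * n ^ 2 + 2 * δ ^ 2) :
    Real.cosh a + Real.cosh b ≤ 2 * (Real.cosh n * Real.cosh δ) := by
  have e : 2 * (Real.cosh n * Real.cosh δ) = Real.cosh (n + δ) + Real.cosh (n - δ) := by
    rw [Real.cosh_add, Real.cosh_sub]; ring
  rw [e]
  refine hasSum_le (fun k => ?_) ((Real.hasSum_cosh a).add (Real.hasSum_cosh b))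
    ((Real.hasSum_cosh (n + δ)).add (Real.hasSum_cosh (n - δ)))
  rw [← add_div, ← add_div, pow_mul, pow_mul, pow_mul, pow_mul]
  gcongr ?_ / _
  exact pow_add_pow_le_of_le_of_add_le (sq_nonneg _) (sq_nonneg _) (sq_nonneg _)
    (pow_le_pow_left₀ ha han 2) (pow_le_pow_left₀ hb hbn 2) (by linarith) k

theorem cosh_add_le_exp_mul_cosh {a b : ℝ} (hb : 0 ≤ b) :
    Real.cosh (a + b) ≤ Real.exp b * Real.cosh a := by
  rw [Real.cosh_eq, Real.cosh_eq, neg_add, Real.exp_add, Real.exp_add]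
  have : Real.exp (-b) ≤ Real.exp b := Real.exp_le_exp.2 (by linarith)
  nlinarith [mul_le_mul_of_nonneg_left this (Real.exp_pos (-a)).le]

/-- The left side is `1 + (exp a - 1) ^ 2`. For `a ≥ 1` it is at most `exp (2 * a)`; for `a ≤ 1` a
Taylor bound suffices. -/
theorem one_add_two_mul_exp_mul_cosh_sub_one_le {a : ℝ} (ha : 0 ≤ a) :
    1 + 2 * Real.exp a * (Real.cosh a - 1) ≤ Real.exp (2 * a ^ 2) := by
  have e : 1 + 2 * Real.exp a * (Real.cosh a - 1) = 1 + (Real.exp a - 1) ^ 2 := by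
    have : Real.exp a * Real.exp (-a) = 1 := by rw [← Real.exp_add]; simp
    rw [Real.cosh_eq]
    linear_combination this
  have h1 : 1 ≤ Real.exp a := Real.one_le_exp ha
  rw [e]
  rcases le_total 1 a with h | h
  · have h2 : Real.exp (2 * a) ≤ Real.exp (2 * a ^ 2) := Real.exp_le_exp.2 (by nlinarith)
    have h3 : Real.exp (2 * a) = Real.exp a ^ 2 := by rw [← Real.exp_nat_mul]; norm_num
    nlinarith
  · have h2 := Real.exp_bound' ha h (n := 3) (by norm_num)
    norm_num [Finset.sum_range_succ, Nat.factorial] at h2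
    have h3 : Real.exp a - 1 ≤ a * (1 + 3 / 4 * a) := by nlinarith [pow_nonneg ha 2]
    have h4 : (Real.exp a - 1) ^ 2 ≤ (a * (1 + 3 / 4 * a)) ^ 2 :=
      pow_le_pow_left₀ (by linarith) h3 2
    have h5 := Real.quadratic_le_exp_of_nonneg (x := 2 * a ^ 2) (by positivity)
    nlinarith [mul_nonneg (sq_nonneg a) (sq_nonneg (a - 1 / 2)), sq_nonneg a, sq_nonneg (a^2)]

end HyperbolicCosine

/-! ### Recentring an adapted bounded sequence. -/

section Recenter

theorem partialSum_zero {Ω B : Type*} [AddCommMonoid B] (X : ℕ → Ω → B) (ω : Ω) :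
    partialSum X 0 ω = 0 := by simp [partialSum]

theorem partialSum_succ {Ω B : Type*} [AddCommMonoid B] (X : ℕ → Ω → B) (n : ℕ) (ω : Ω) :
    partialSum X (n + 1) ω = partialSum X n ω + X (n + 1) ω := by
  rw [partialSum, partialSum, Finset.sum_Icc_succ_top (by omega)]

theorem stronglyMeasurable_partialSum {Ω B : Type*} [NormedAddCommGroup B]
    {m : MeasurableSpace Ω} {ℱ : Filtration ℕ m} {X : ℕ → Ω → B}
    (hX : ∀ i, 1 ≤ i → StronglyMeasurable[ℱ i] (X i)) (n : ℕ) :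
    StronglyMeasurable[ℱ n] (partialSum X n) := by
  have : partialSum X n = ∑ i ∈ Finset.Icc 1 n, X i := by ext ω; simp [partialSum]
  rw [this]
  refine Finset.stronglyMeasurable_sum _ fun i hi => ?_
  rw [Finset.mem_Icc] at hi
  exact (hX i hi.1).mono (ℱ.mono hi.2)

variable {B : Type*} [NormedAddCommGroup B] [NormedSpace ℝ B]
  {Ω : Type*} {m : MeasurableSpace Ω} {μ : Measure Ω}

/-- The sequence `Y` recentered so as to be a martingale difference sequence from index `2` on. -/
noncomputable def recenter (μ : Measure Ω) (ℱ : Filtration ℕ m) (Y : ℕ → Ω → B) : ℕ → Ω → B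
  | 0 => 0
  | 1 => Y 1
  | i + 2 => Y (i + 2) - μ[Y (i + 2) | ℱ (i + 1)]

theorem stronglyMeasurable_recenter {ℱ : Filtration ℕ m} {Y : ℕ → Ω → B}
    (hY : ∀ i, 1 ≤ i → StronglyMeasurable[ℱ i] (Y i)) :
    ∀ i, 1 ≤ i → StronglyMeasurable[ℱ i] (recenter μ ℱ Y i)
  | 1, _ => hY 1 le_rfl
  | i + 2, h => (hY (i + 2) h).sub (stronglyMeasurable_condExp.mono (ℱ.mono (by omega)))

variable [CompleteSpace B]

theorem ae_norm_recenter_le {ℱ : Filtration ℕ m} {Y : ℕ → Ω → B} {u : ℝ} (hu : 0 ≤ u)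
    (hYu : ∀ i ω, ‖Y i ω‖ ≤ u) : ∀ i, ∀ᵐ ω ∂μ, ‖recenter μ ℱ Y i ω‖ ≤ 2 * u
  | 0 => by simp [recenter, hu]
  | 1 => ae_of_all _ fun ω => (hYu 1 ω).trans (by linarith)
  | i + 2 => by
    filter_upwards [ae_bdd_norm_condExp_of_ae_bdd_norm (μ := μ) (m := ℱ (i + 1))
      (ae_of_all _ (hYu (i + 2)))] with ω hω
    refine (norm_sub_le _ _).trans ?_
    linarith [hYu (i + 2) ω]

theorem ae_norm_partialSum_recenter_le {ℱ : Filtration ℕ m} {Y : ℕ → Ω → B} {u : ℝ} (hu : 0 ≤ u)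
    (hYu : ∀ i ω, ‖Y i ω‖ ≤ u) (n : ℕ) :
    ∀ᵐ ω ∂μ, ‖partialSum (recenter μ ℱ Y) n ω‖ ≤ n * (2 * u) := by
  filter_upwards [ae_all_iff.2 (ae_norm_recenter_le (μ := μ) (ℱ := ℱ) hu hYu)] with ω hω
  refine (norm_sum_le_of_le _ fun i _ => hω i).trans ?_
  simp

end Recenter

/-! ### Exponential moments of bounded martingales. -/

section CoshSeminorm

variable {B : Type*} [NormedAddCommGroup B] [NormedSpace ℝ B]

theorem Seminorm.continuous_of_le_mul_norm {N : Seminorm ℝ B} {M : ℝ} (hM : 0 ≤ M)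
    (hNM : ∀ x, N x ≤ M * ‖x‖) : Continuous N := by
  refine (LipschitzWith.of_dist_le_mul (K := M.toNNReal) fun x y => ?_).continuous
  rw [Real.dist_eq, dist_eq_norm, Real.coe_toNNReal _ hM]
  exact (abs_sub_map_le_sub N x y).trans (hNM _)

theorem convexOn_cosh_seminorm (N : Seminorm ℝ B) :
    ConvexOn ℝ Set.univ fun x => Real.cosh (N x) := by
  have hcosh : ConvexOn ℝ Set.univ Real.cosh := by
    have h1 : ConvexOn ℝ Set.univ fun x : ℝ => Real.exp (-x) := by
      exact convexOn_exp.comp_linearMap (-LinearMap.id)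
    have h2 := (convexOn_exp.add h1).smul (c := (1 / 2 : ℝ)) (by norm_num)
    refine h2.congr fun x _ => ?_
    simp only [Pi.add_apply, smul_eq_mul, Real.cosh_eq]
    ring
  refine ⟨convex_univ, fun x _ y _ s t hs ht hst => ?_⟩
  refine le_trans ?_ (hcosh.2 (Set.mem_univ (N x)) (Set.mem_univ (N y)) hs ht hst)
  rw [Real.cosh_le_cosh, abs_of_nonneg (apply_nonneg N _),
    abs_of_nonneg (add_nonneg (smul_nonneg hs (apply_nonneg N x))
      (smul_nonneg ht (apply_nonneg N y)))]
  exact N.convexOn.2 (Set.mem_univ x) (Set.mem_univ y) hs ht hst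

variable {Ω : Type*} {F m : MeasurableSpace Ω} {μ : Measure Ω} [IsProbabilityMeasure μ]
  {N : Seminorm ℝ B} {M u : ℝ}

theorem integrable_cosh_seminorm (hM : 0 ≤ M) (hNM : ∀ x, N x ≤ M * ‖x‖)
    {V : Ω → B} (hV : AEStronglyMeasurable V μ) {K : ℝ} (hVK : ∀ᵐ ω ∂μ, ‖V ω‖ ≤ K) :
    Integrable (fun ω => Real.cosh (N (V ω))) μ := by
  have hcont : Continuous fun x => Real.cosh (N x) :=
    Real.continuous_cosh.comp (Seminorm.continuous_of_le_mul_norm hM hNM)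
  refine Integrable.of_bound (hcont.comp_aestronglyMeasurable hV) (Real.cosh (M * K)) ?_
  filter_upwards [hVK] with ω hω
  rw [Real.norm_of_nonneg (Real.cosh_pos _).le, Real.cosh_le_cosh,
    abs_of_nonneg (apply_nonneg N _)]
  exact ((hNM _).trans (mul_le_mul_of_nonneg_left hω hM)).trans (le_abs_self _)

variable [CompleteSpace B]

theorem integral_cosh_seminorm_condExp_le (hM : 0 ≤ M) (hNM : ∀ x, N x ≤ M * ‖x‖) (hF : F ≤ m)
    {V : Ω → B} (hV : AEStronglyMeasurable V μ) {K : ℝ} (hVK : ∀ᵐ ω ∂μ, ‖V ω‖ ≤ K) :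
    ∫ ω, Real.cosh (N (μ[V | F] ω)) ∂μ ≤ ∫ ω, Real.cosh (N (V ω)) ∂μ := by
  have hcont : Continuous fun x => Real.cosh (N x) :=
    Real.continuous_cosh.comp (Seminorm.continuous_of_le_mul_norm hM hNM)
  have h := (convexOn_cosh_seminorm N).map_condExp_le_univ (μ := μ) hF hcont.lowerSemicontinuous
    (Integrable.of_bound hV K hVK) (integrable_cosh_seminorm hM hNM hV hVK)
  refine (integral_mono_ae (integrable_cosh_seminorm hM hNM
    (stronglyMeasurable_condExp.mono hF).aestronglyMeasurable
    (ae_bdd_norm_condExp_of_ae_bdd_norm hVK)) integrable_condExp h).trans_eq ?_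
  rw [integral_condExp hF]
  rfl

/-- Put `c = μ[Y | F]` and `T = S - c`. Smoothness at `T` in the direction `Y` controls the sum over
`T ± Y`; conditional Jensen bounds the `T - Y` term below by the one for `T - c`, which convexity
compares with `S` and `T`. Perturbing by `Y` rather than by `Y - c`, whose norm is bounded only by
`2 * u`, yields the constant `2` where the direct argument gives `4`. -/
theorem integral_cosh_add_sub_condExp_le (hM : 0 ≤ M) (hNM : ∀ x, N x ≤ M * ‖x‖)
    (hsm : ∀ x y, N (x + y) ^ 2 + N (x - y) ^ 2 ≤ 2 * N x ^ 2 + 2 * (M * ‖y‖) ^ 2)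
    (hu : 0 ≤ u) (hF : F ≤ m) {S Y : Ω → B} (hS : StronglyMeasurable[F] S) {K : ℝ}
    (hSK : ∀ᵐ ω ∂μ, ‖S ω‖ ≤ K) (hY : AEStronglyMeasurable Y μ) (hYu : ∀ᵐ ω ∂μ, ‖Y ω‖ ≤ u) :
    ∫ ω, Real.cosh (N (S ω + (Y ω - μ[Y | F] ω))) ∂μ ≤
      Real.exp (2 * (M * u) ^ 2) * ∫ ω, Real.cosh (N (S ω)) ∂μ := by
  set c : Ω → B := μ[Y | F] with hc
  have hcm : StronglyMeasurable[F] c := stronglyMeasurable_condExp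
  have hcu : ∀ᵐ ω ∂μ, ‖c ω‖ ≤ u := ae_bdd_norm_condExp_of_ae_bdd_norm hYu
  set T : Ω → B := S - c with hT
  have hTm : StronglyMeasurable[F] T := hS.sub hcm
  have hSm' : AEStronglyMeasurable S μ := (hS.mono hF).aestronglyMeasurable
  have hcm' : AEStronglyMeasurable c μ := (hcm.mono hF).aestronglyMeasurable
  have hTm' : AEStronglyMeasurable T μ := (hTm.mono hF).aestronglyMeasurable
  have hTK : ∀ᵐ ω ∂μ, ‖T ω‖ ≤ K + u := by
    filter_upwards [hSK, hcu] with ω h1 h2 using (norm_sub_le _ _).trans (add_le_add h1 h2)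
  have hadd : ∀ {V W : Ω → B} {a b : ℝ}, (∀ᵐ ω ∂μ, ‖V ω‖ ≤ a) → (∀ᵐ ω ∂μ, ‖W ω‖ ≤ b) →
      ∀ᵐ ω ∂μ, ‖(V + W) ω‖ ≤ a + b := fun h1 h2 => by
    filter_upwards [h1, h2] with ω h1 h2 using (norm_add_le _ _).trans (add_le_add h1 h2)
  have hsub : ∀ {V W : Ω → B} {a b : ℝ}, (∀ᵐ ω ∂μ, ‖V ω‖ ≤ a) → (∀ᵐ ω ∂μ, ‖W ω‖ ≤ b) →
      ∀ᵐ ω ∂μ, ‖(V - W) ω‖ ≤ a + b := fun h1 h2 => by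
    filter_upwards [h1, h2] with ω h1 h2 using (norm_sub_le _ _).trans (add_le_add h1 h2)
  have iS := integrable_cosh_seminorm hM hNM hSm' hSK
  have iT := integrable_cosh_seminorm hM hNM hTm' hTK
  have iTpY := integrable_cosh_seminorm hM hNM (hTm'.add hY) (hadd hTK hYu)
  have iTmY := integrable_cosh_seminorm hM hNM (hTm'.sub hY) (hsub hTK hYu)
  have iTmc := integrable_cosh_seminorm hM hNM (hTm'.sub hcm') (hsub hTK hcu)
  have hcosh : ∀ {x y : ℝ}, 0 ≤ x → x ≤ y → Real.cosh x ≤ Real.cosh y := fun hx hxy => by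
    rwa [Real.cosh_le_cosh, abs_of_nonneg hx, abs_of_nonneg (hx.trans hxy)]
  have h1 : ∫ ω, Real.cosh (N ((T + Y) ω)) ∂μ + ∫ ω, Real.cosh (N ((T - Y) ω)) ∂μ ≤
      2 * Real.cosh (M * u) * ∫ ω, Real.cosh (N (T ω)) ∂μ := by
    rw [← integral_add iTpY iTmY, ← integral_const_mul]
    refine integral_mono_ae (iTpY.add iTmY) (iT.const_mul _) ?_
    filter_upwards [hYu] with ω hω
    have hy : M * ‖Y ω‖ ≤ M * u := mul_le_mul_of_nonneg_left hω hM
    have h := cosh_add_cosh_le (a := N (T ω + Y ω)) (b := N (T ω - Y ω)) (n := N (T ω))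
      (δ := M * ‖Y ω‖) (apply_nonneg N _) (apply_nonneg N _)
      ((map_add_le_add N _ _).trans (add_le_add_right (hNM _) _))
      ((map_sub_le_add N _ _).trans (add_le_add_right (hNM _) _)) (hsm _ _)
    have h' := mul_le_mul_of_nonneg_left (hcosh (mul_nonneg hM (norm_nonneg (Y ω))) hy)
      (Real.cosh_pos (N (T ω))).le
    simp only [Pi.add_apply, Pi.sub_apply] at h ⊢
    linarith
  have h2 : ∫ ω, Real.cosh (N ((T - c) ω)) ∂μ ≤ ∫ ω, Real.cosh (N ((T - Y) ω)) ∂μ := by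
    have hYi : Integrable Y μ := Integrable.of_bound hY u hYu
    have hTi : Integrable T μ := Integrable.of_bound hTm' _ hTK
    have hce : μ[T - Y | F] =ᵐ[μ] T - c := by
      refine (condExp_sub hTi hYi F).trans ?_
      rw [condExp_of_stronglyMeasurable hF hTm hTi]
    refine le_trans (le_of_eq (integral_congr_ae ?_))
      (integral_cosh_seminorm_condExp_le hM hNM hF (hTm'.sub hY) (hsub hTK hYu))
    filter_upwards [hce] with ω hω
    rw [hω]
  -- `T - c = S - 2 • c`, so `T` is the midpoint of `S` and `T - c`.
  have h3 : 2 * ∫ ω, Real.cosh (N (T ω)) ∂μ ≤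
      ∫ ω, Real.cosh (N (S ω)) ∂μ + ∫ ω, Real.cosh (N ((T - c) ω)) ∂μ := by
    rw [← integral_const_mul, ← integral_add iS iTmc]
    refine integral_mono (iT.const_mul _) (iS.add iTmc) fun ω => ?_
    have h := (convexOn_cosh_seminorm N).2 (Set.mem_univ (S ω)) (Set.mem_univ ((T - c) ω))
      (by norm_num : (0 : ℝ) ≤ 1 / 2) (by norm_num : (0 : ℝ) ≤ 1 / 2) (by norm_num)
    have e : (1 / 2 : ℝ) • S ω + (1 / 2 : ℝ) • (T - c) ω = T ω := by
      simp only [hT, Pi.sub_apply]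
      module
    simp only [e, smul_eq_mul] at h
    simp only
    linarith
  have h4 : ∫ ω, Real.cosh (N (T ω)) ∂μ ≤
      Real.exp (M * u) * ∫ ω, Real.cosh (N (S ω)) ∂μ := by
    rw [← integral_const_mul]
    refine integral_mono_ae iT (iS.const_mul _) ?_
    filter_upwards [hcu] with ω hω
    refine (hcosh (apply_nonneg N _) ?_).trans
      (cosh_add_le_exp_mul_cosh (a := N (S ω)) (mul_nonneg hM hu))
    exact (map_sub_le_add N _ _).trans
      (add_le_add_right ((hNM _).trans (mul_le_mul_of_nonneg_left hω hM)) _)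
  have h5 : 0 ≤ ∫ ω, Real.cosh (N (S ω)) ∂μ := integral_nonneg fun ω => (Real.cosh_pos _).le
  have h6 := mul_le_mul_of_nonneg_right
    (one_add_two_mul_exp_mul_cosh_sub_one_le (mul_nonneg hM hu)) h5
  have h7 := mul_le_mul_of_nonneg_left h4
    (show 0 ≤ 2 * (Real.cosh (M * u) - 1) by linarith [Real.one_le_cosh (M * u)])
  have e : ∀ ω, S ω + (Y ω - c ω) = (T + Y) ω := fun ω => by
    simp only [hT, Pi.add_apply, Pi.sub_apply]; abel
  simp only [e]
  linarith

theorem integral_cosh_partialSum_recenter_le (hM : 0 ≤ M) (hNM : ∀ x, N x ≤ M * ‖x‖)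
    (hsm : ∀ x y, N (x + y) ^ 2 + N (x - y) ^ 2 ≤ 2 * N x ^ 2 + 2 * (M * ‖y‖) ^ 2)
    (hu : 0 ≤ u) {ℱ : Filtration ℕ m} {Y : ℕ → Ω → B}
    (hY : ∀ i, 1 ≤ i → StronglyMeasurable[ℱ i] (Y i)) (hYu : ∀ i ω, ‖Y i ω‖ ≤ u) :
    ∀ n : ℕ, ∫ ω, Real.cosh (N (partialSum (recenter μ ℱ Y) n ω)) ∂μ ≤
      Real.exp (n * (2 * (M * u) ^ 2))
  | 0 => by simp [partialSum_zero]
  | 1 => by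
    simp only [partialSum_succ, partialSum_zero, recenter, zero_add, Nat.cast_one, one_mul]
    refine (integral_mono (g := fun _ => Real.cosh (M * u)) (integrable_cosh_seminorm hM hNM
      ((hY 1 le_rfl).mono (ℱ.le 1)).aestronglyMeasurable (ae_of_all _ (hYu 1)))
      (integrable_const _) fun ω => ?_).trans ?_
    · simp only
      rw [Real.cosh_le_cosh, abs_of_nonneg (apply_nonneg N _)]
      exact ((hNM _).trans (mul_le_mul_of_nonneg_left (hYu 1 ω) hM)).trans (le_abs_self _)
    · simp only [integral_const, probReal_univ, one_smul]
      refine (Real.cosh_le_exp_half_sq _).trans (Real.exp_le_exp.2 ?_)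
      linarith [sq_nonneg (M * u)]
  | n + 2 => by
    have ih := integral_cosh_partialSum_recenter_le hM hNM hsm hu hY hYu (n + 1)
    have h := integral_cosh_add_sub_condExp_le hM hNM hsm hu (ℱ.le (n + 1))
      (stronglyMeasurable_partialSum (stronglyMeasurable_recenter (μ := μ) hY) (n + 1))
      (ae_norm_partialSum_recenter_le hu hYu (n + 1))
      ((hY (n + 2) (by omega)).mono (ℱ.le _)).aestronglyMeasurable
      (ae_of_all _ (hYu (n + 2)))
    simp only [partialSum_succ _ (n + 1)]
    refine h.trans ((mul_le_mul_of_nonneg_left ih (Real.exp_pos _).le).trans_eq ?_)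
    rw [← Real.exp_add]
    congr 1
    push_cast
    ring

end CoshSeminorm

theorem IsRDSmooth.measureReal_norm_partialSum_recenter_le {B : Type u} [NormedAddCommGroup B]
    [NormedSpace ℝ B] [CompleteSpace B] [TopologicalSpace.SeparableSpace B] {D : ℝ} (hD : 0 < D)
    (hB : IsRDSmooth.{u, v} B 2 D) {Ω : Type*} {m : MeasurableSpace Ω} {μ : Measure Ω}
    [IsProbabilityMeasure μ] {ℱ : Filtration ℕ m} {Y : ℕ → Ω → B} {u : ℝ} (hu : 0 ≤ u)
    (hY : ∀ i, 1 ≤ i → StronglyMeasurable[ℱ i] (Y i)) (hYu : ∀ i ω, ‖Y i ω‖ ≤ u)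
    {l : ℝ} (hl : 0 ≤ l) (r : ℝ) (n : ℕ) :
    μ.real {ω | r < ‖partialSum (recenter μ ℱ Y) n ω‖} ≤
      2 * Real.exp (2 * n * D * l ^ 2 * u ^ 2 - l * r) := by
  obtain ⟨N₀, h1, h2, h3⟩ := exists_smooth_seminorm
    (fun k (x : B) r h => hB.dyadicValue_le hD (k := k) (x := x) (r := r) h)
  -- The parameter `l` of the exponential moment is absorbed into the seminorm.
  let N : Seminorm ℝ B := l.toNNReal • N₀
  have hN : ∀ x, N x = l * N₀ x := fun x => by
    rw [_root_.smul_apply, NNReal.smul_def, Real.coe_toNNReal _ hl, smul_eq_mul]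
  have hM : 0 ≤ l * √D := by positivity
  have hNM : ∀ x, N x ≤ l * √D * ‖x‖ := fun x => by
    rw [hN, mul_assoc]; exact mul_le_mul_of_nonneg_left (h2 x) hl
  have hsm : ∀ x y, N (x + y) ^ 2 + N (x - y) ^ 2 ≤ 2 * N x ^ 2 + 2 * (l * √D * ‖y‖) ^ 2 :=
    fun x y => by
      simp only [hN]
      have := mul_le_mul_of_nonneg_left (h3 x y) (sq_nonneg l)
      nlinarith
  have hint := integral_cosh_partialSum_recenter_le (μ := μ) hM hNM hsm hu hY hYu n
  have hi := integrable_cosh_seminorm hM hNM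
    ((stronglyMeasurable_partialSum (stronglyMeasurable_recenter (μ := μ) hY) n).mono
      (ℱ.le n)).aestronglyMeasurable (ae_norm_partialSum_recenter_le (μ := μ) hu hYu n)
  have hmarkov := mul_meas_ge_le_integral_of_nonneg
    (ae_of_all _ fun ω => (Real.cosh_pos (N (partialSum (recenter μ ℱ Y) n ω))).le) hi
    (Real.exp (l * r) / 2)
  have hsub : {ω | r < ‖partialSum (recenter μ ℱ Y) n ω‖} ⊆
      {ω | Real.exp (l * r) / 2 ≤ Real.cosh (N (partialSum (recenter μ ℱ Y) n ω))} := by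
    intro ω hω
    have h4 : l * r ≤ N (partialSum (recenter μ ℱ Y) n ω) := by
      rw [hN]
      exact mul_le_mul_of_nonneg_left ((le_of_lt hω).trans (h1 _)) hl
    have h5 := Real.exp_le_exp.2 h4
    rw [Set.mem_ofPred_eq, Real.cosh_eq]
    have := Real.exp_pos (-N (partialSum (recenter μ ℱ Y) n ω))
    linarith
  have hmono := measureReal_mono (μ := μ) hsub
  have he : Real.exp (2 * n * D * l ^ 2 * u ^ 2 - l * r) * Real.exp (l * r) =
      Real.exp (n * (2 * (l * √D * u) ^ 2)) := by
    rw [← Real.exp_add, mul_pow, mul_pow, Real.sq_sqrt hD.le]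
    congr 1
    ring
  have hpos := Real.exp_pos (l * r)
  have h6 : Real.exp (l * r) / 2 * μ.real {ω | r < ‖partialSum (recenter μ ℱ Y) n ω‖} ≤
      Real.exp (2 * n * D * l ^ 2 * u ^ 2 - l * r) * Real.exp (l * r) := by
    rw [he]
    exact ((mul_le_mul_of_nonneg_left hmono (by positivity)).trans hmarkov).trans hint
  refine le_of_mul_le_mul_left ?_ (half_pos hpos)
  linarith

/-! ### Stopping, to pass from the maximum to the final sum. -/

section Stopping

variable {B : Type*} [NormedAddCommGroup B] {Ω : Type*}

/-- The differences of the sequence of partial sums of `X`, stopped once its norm exceeds `r`. -/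
noncomputable def stoppedDifference (X : ℕ → Ω → B) (r : ℝ) (i : ℕ) : Ω → B :=
  {ω | ∀ k < i, ‖partialSum X k ω‖ ≤ r}.indicator (X i)

theorem norm_stoppedDifference_le (X : ℕ → Ω → B) (r : ℝ) (i : ℕ) (ω : Ω) :
    ‖stoppedDifference X r i ω‖ ≤ ‖X i ω‖ :=
  norm_indicator_le_norm_self _ _

theorem lt_norm_partialSum_stoppedDifference {X : ℕ → Ω → B} {r : ℝ} {n : ℕ} {ω : Ω} {k : ℕ}
    (hkn : k ≤ n) (hk : r < ‖partialSum X k ω‖) :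
    r < ‖partialSum (stoppedDifference X r) n ω‖ := by
  classical
  have hex : ∃ k, r < ‖partialSum X k ω‖ := ⟨k, hk⟩
  have hlt := Nat.find_spec hex
  have hmin : ∀ j < Nat.find hex, ‖partialSum X j ω‖ ≤ r := fun j hj =>
    not_lt.1 (Nat.find_min hex hj)
  have hle : Nat.find hex ≤ n := (Nat.find_min' hex hk).trans hkn
  set τ := Nat.find hex
  suffices h : partialSum (stoppedDifference X r) n ω = partialSum X τ ω by rwa [h]
  rw [partialSum, partialSum,
    ← Finset.sum_subset (Finset.Icc_subset_Icc_right hle : Finset.Icc 1 τ ⊆ Finset.Icc 1 n)]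
  · refine Finset.sum_congr rfl fun i hi => Set.indicator_of_mem ?_ _
    exact fun j hj => hmin j (hj.trans_le (Finset.mem_Icc.1 hi).2)
  · intro i hi hi'
    refine Set.indicator_of_notMem (fun h => ?_) _
    have hτi : τ < i := by
      rw [Finset.mem_Icc] at hi hi'
      omega
    exact not_le.2 hlt (h τ hτi)

theorem lt_maxNormPartialSum_iff {X : ℕ → Ω → B} {n : ℕ} {ω : Ω} {r : ℝ} (hr : 0 ≤ r) :
    r < maxNormPartialSum X n ω ↔ ∃ k ∈ Finset.Icc 1 n, r < ‖partialSum X k ω‖ := by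
  lift r to NNReal using hr
  simp only [maxNormPartialSum, NNReal.coe_lt_coe, Finset.lt_sup_iff]
  rfl

theorem IsMartingaleDifference.stoppedDifference [NormedSpace ℝ B] [CompleteSpace B]
    {m : MeasurableSpace Ω} {μ : Measure Ω} {ℱ : Filtration ℕ m} {X : ℕ → Ω → B}
    (hX : IsMartingaleDifference μ ℱ X) (r : ℝ) :
    IsMartingaleDifference μ ℱ (stoppedDifference X r) := by
  -- With `j = i` this gives adaptedness, with `j = i - 1` predictability, which lets the indicator
  -- leave the conditional expectation.
  have hset : ∀ i j, i ≤ j + 1 →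
      MeasurableSet[ℱ j] {ω | ∀ k < i, ‖partialSum X k ω‖ ≤ r} := fun i j hij => by
    have : {ω | ∀ k < i, ‖partialSum X k ω‖ ≤ r} =
        ⋂ k ∈ Finset.range i, {ω | ‖partialSum X k ω‖ ≤ r} := by ext; simp
    rw [this]
    refine Finset.measurableSet_biInter _ fun k hk => ?_
    have hkj : k ≤ j := by rw [Finset.mem_range] at hk; omega
    exact ((stronglyMeasurable_partialSum hX.stronglyMeasurable k).mono
      (ℱ.mono hkj)).norm.measurableSet_le stronglyMeasurable_const
  refine ⟨fun i hi => (hX.stronglyMeasurable i hi).indicator (hset i i (by omega)),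
    fun i hi => (hX.integrable i hi).indicator (ℱ.le i _ (hset i i (by omega))),
    fun i hi => ?_⟩
  refine (condExp_indicator (hX.integrable i (by omega)) (hset i (i - 1) (by omega))).trans ?_
  filter_upwards [hX.condExp_eq_zero i hi] with ω hω
  simp [Set.indicator, hω]

end Stopping

/-! ### Truncation and the second moment of the remainder. -/

section Truncation

variable {B : Type*} [NormedAddCommGroup B] {Ω : Type*}

/-- The sequence `X` with the values of norm greater than `u` replaced by `0`. -/
noncomputable def truncated (X : ℕ → Ω → B) (u : ℝ) (i : ℕ) : Ω → B :=
  {ω | ‖X i ω‖ ≤ u}.indicator (X i)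

/-- The part of `X` with norm greater than `u`. -/
noncomputable def exceeding (X : ℕ → Ω → B) (u : ℝ) (i : ℕ) : Ω → B :=
  {ω | ‖X i ω‖ ≤ u}ᶜ.indicator (X i)

theorem norm_truncated_le (X : ℕ → Ω → B) {u : ℝ} (hu : 0 ≤ u) (i : ℕ) (ω : Ω) :
    ‖truncated X u i ω‖ ≤ u := by
  rw [truncated, norm_indicator_eq_indicator_norm]
  exact Set.indicator_apply_le' (fun h => h) fun _ => hu

theorem truncated_add_exceeding (X : ℕ → Ω → B) (u : ℝ) (i : ℕ) :
    truncated X u i + exceeding X u i = X i :=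
  Set.indicator_self_add_compl _ _

theorem mul_norm_exceeding_le (X : ℕ → Ω → B) {u : ℝ} (i : ℕ) (ω : Ω) :
    u * ‖exceeding X u i ω‖ ≤ ‖exceeding X u i ω‖ ^ 2 := by
  by_cases h : ‖X i ω‖ ≤ u
  · simp [exceeding, h]
  · simp only [exceeding, Set.indicator, Set.mem_compl_iff, Set.mem_ofPred_eq, h, not_false_iff,
      if_true]
    nlinarith [norm_nonneg (X i ω), not_le.1 h]

variable [NormedSpace ℝ B] [CompleteSpace B] {m : MeasurableSpace Ω} {μ : Measure Ω}
  {ℱ : Filtration ℕ m} {X : ℕ → Ω → B}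

theorem IsMartingaleDifference.stronglyMeasurable_truncated (hX : IsMartingaleDifference μ ℱ X)
    (u : ℝ) (i : ℕ) (hi : 1 ≤ i) : StronglyMeasurable[ℱ i] (truncated X u i) :=
  (hX.stronglyMeasurable i hi).indicator
    ((hX.stronglyMeasurable i hi).norm.measurableSet_le stronglyMeasurable_const)

theorem IsMartingaleDifference.integrable_truncated (hX : IsMartingaleDifference μ ℱ X)
    (u : ℝ) (i : ℕ) (hi : 1 ≤ i) : Integrable (truncated X u i) μ :=
  (hX.integrable i hi).indicator (ℱ.le i _
    ((hX.stronglyMeasurable i hi).norm.measurableSet_le stronglyMeasurable_const))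

theorem IsMartingaleDifference.integrable_exceeding (hX : IsMartingaleDifference μ ℱ X)
    (u : ℝ) (i : ℕ) (hi : 1 ≤ i) : Integrable (exceeding X u i) μ :=
  (hX.integrable i hi).indicator (ℱ.le i _
    ((hX.stronglyMeasurable i hi).norm.measurableSet_le stronglyMeasurable_const)).compl

theorem IsMartingaleDifference.condExp_truncated (hX : IsMartingaleDifference μ ℱ X)
    (u : ℝ) (i : ℕ) :
    μ[truncated X u (i + 2) | ℱ (i + 1)] =ᵐ[μ] -μ[exceeding X u (i + 2) | ℱ (i + 1)] := by
  have h := condExp_add (hX.integrable_truncated u (i + 2) (by omega))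
    (hX.integrable_exceeding u (i + 2) (by omega)) (ℱ (i + 1))
  rw [truncated_add_exceeding] at h
  filter_upwards [h, hX.condExp_eq_zero (i + 2) (by omega)] with ω h1 h2
  rw [Nat.add_sub_assoc (by norm_num)] at h2
  rw [h2] at h1
  exact eq_neg_of_add_eq_zero_left h1.symm

/-- For `i ≥ 2` the remainder is `W + c`, where `W` is the exceeding part and `c`, the conditional
mean of the truncated part, equals `-μ[W | ℱ (i - 1)]`. As `‖c‖ ≤ u`, and `‖W‖ > u` wherever `W ≠
0`, `𝔼 ‖c‖ ^ 2 ≤ u * 𝔼 ‖c‖ ≤ u * 𝔼 ‖W‖ ≤ 𝔼 ‖W‖ ^ 2`, even if the last is infinite. -/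
theorem IsMartingaleDifference.lintegral_sub_recenter_truncated_le
    (hX : IsMartingaleDifference μ ℱ X) {u : ℝ} (hu : 0 ≤ u) {i : ℕ} (hi : 1 ≤ i) :
    ∫⁻ ω, ‖(X i - recenter μ ℱ (truncated X u) i) ω‖ₑ ^ (2 : ℝ) ∂μ ≤
      4 * ∫⁻ ω, ENNReal.ofReal (‖exceeding X u i ω‖ ^ 2) ∂μ := by
  have hpow : ∀ z : B, ‖z‖ₑ ^ (2 : ℝ) = ENNReal.ofReal (‖z‖ ^ 2) := fun z => by
    rw [← ofReal_norm, ENNReal.ofReal_rpow_of_nonneg (norm_nonneg _) (by norm_num)]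
    norm_num
  have hdec : ∀ i, X i - truncated X u i = exceeding X u i := fun i => by
    rw [sub_eq_iff_eq_add', truncated_add_exceeding]
  simp only [hpow]
  match i, hi with
  | 1, _ =>
    rw [recenter, hdec]
    exact le_mul_of_one_le_left zero_le (by norm_num)
  | i + 2, hi =>
    have hW := hX.integrable_exceeding u (i + 2) hi
    set W := exceeding X u (i + 2) with hWdef
    set c := μ[truncated X u (i + 2) | ℱ (i + 1)] with hc
    have hcu : ∀ᵐ ω ∂μ, ‖c ω‖ ≤ u :=
      ae_bdd_norm_condExp_of_ae_bdd_norm (ae_of_all _ (norm_truncated_le X hu (i + 2)))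
    have hcW : ∫ ω, ‖c ω‖ ∂μ ≤ ∫ ω, ‖W ω‖ ∂μ := by
      refine le_trans (le_of_eq (integral_congr_ae ?_))
        (integral_norm_condExp_le (m := ℱ (i + 1)) W)
      filter_upwards [hX.condExp_truncated u i] with ω hω
      rw [hc, hω, Pi.neg_apply, norm_neg]
    have hci : Integrable c μ := integrable_condExp
    have hc2 : ∫⁻ ω, ENNReal.ofReal (‖c ω‖ ^ 2) ∂μ ≤ ∫⁻ ω, ENNReal.ofReal (‖W ω‖ ^ 2) ∂μ :=
      calc ∫⁻ ω, ENNReal.ofReal (‖c ω‖ ^ 2) ∂μ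
          ≤ ∫⁻ ω, ENNReal.ofReal (u * ‖c ω‖) ∂μ := by
            refine lintegral_mono_ae ?_
            filter_upwards [hcu] with ω hω
            refine ENNReal.ofReal_le_ofReal ?_
            rw [sq]
            exact mul_le_mul_of_nonneg_right hω (norm_nonneg _)
        _ = ENNReal.ofReal (∫ ω, u * ‖c ω‖ ∂μ) :=
            (ofReal_integral_eq_lintegral_ofReal (hci.norm.const_mul u)
              (ae_of_all _ fun ω => mul_nonneg hu (norm_nonneg _))).symm
        _ ≤ ENNReal.ofReal (∫ ω, u * ‖W ω‖ ∂μ) := by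
            rw [integral_const_mul, integral_const_mul]
            exact ENNReal.ofReal_le_ofReal (mul_le_mul_of_nonneg_left hcW hu)
        _ = ∫⁻ ω, ENNReal.ofReal (u * ‖W ω‖) ∂μ :=
            ofReal_integral_eq_lintegral_ofReal (hW.norm.const_mul u)
              (ae_of_all _ fun ω => mul_nonneg hu (norm_nonneg _))
        _ ≤ _ := lintegral_mono fun ω =>
            ENNReal.ofReal_le_ofReal (mul_norm_exceeding_le X (i + 2) ω)
    have hpt : ∀ ω, ENNReal.ofReal (‖(X (i + 2) - recenter μ ℱ (truncated X u) (i + 2)) ω‖ ^ 2) ≤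
        2 * ENNReal.ofReal (‖W ω‖ ^ 2) + 2 * ENNReal.ofReal (‖c ω‖ ^ 2) := fun ω => by
      have e : (X (i + 2) - recenter μ ℱ (truncated X u) (i + 2)) ω = W ω + c ω := by
        rw [recenter, sub_sub_eq_add_sub, add_sub_right_comm, hdec]
        rfl
      rw [e, ← ENNReal.ofReal_ofNat, ← ENNReal.ofReal_mul (by norm_num),
        ← ENNReal.ofReal_mul (by norm_num), ← ENNReal.ofReal_add (by positivity) (by positivity)]
      refine ENNReal.ofReal_le_ofReal ?_
      nlinarith [norm_add_le (W ω) (c ω), norm_nonneg (W ω + c ω), sq_nonneg (‖W ω‖ - ‖c ω‖),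
        norm_nonneg (W ω), norm_nonneg (c ω)]
    refine (lintegral_mono hpt).trans ?_
    rw [lintegral_add_right' _ ((hci.1.norm.aemeasurable.pow_const 2).ennreal_ofReal.const_mul _),
      lintegral_const_mul' _ _ (by norm_num), lintegral_const_mul' _ _ (by norm_num)]
    refine (add_le_add_right (mul_le_mul_right hc2 2) _).trans_eq ?_
    rw [← add_mul]
    norm_num

variable [IsProbabilityMeasure μ]

theorem IsMartingaleDifference.sub_recenter_truncated (hX : IsMartingaleDifference μ ℱ X)
    (u : ℝ) :
    IsMartingaleDifference μ ℱ fun i => X i - recenter μ ℱ (truncated X u) i := by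
  have hi : ∀ i, 1 ≤ i → Integrable (recenter μ ℱ (truncated X u) i) μ
    | 1, _ => hX.integrable_truncated u 1 le_rfl
    | i + 2, h => (hX.integrable_truncated u (i + 2) h).sub integrable_condExp
  refine ⟨fun i h => (hX.stronglyMeasurable i h).sub (stronglyMeasurable_recenter
    (hX.stronglyMeasurable_truncated u) i h), fun i h => (hX.integrable i h).sub (hi i h),
    fun i h => ?_⟩
  obtain ⟨i, rfl⟩ : ∃ l, i = l + 2 := ⟨i - 2, by omega⟩
  have h1 := condExp_sub (hX.integrable (i + 2) (by omega)) (hi (i + 2) (by omega)) (ℱ (i + 1))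
  have h2 := condExp_sub (hX.integrable_truncated u (i + 2) (by omega))
    (integrable_condExp (m := ℱ (i + 1)) (f := truncated X u (i + 2))) (ℱ (i + 1))
  rw [condExp_of_stronglyMeasurable (ℱ.le _) stronglyMeasurable_condExp integrable_condExp,
    sub_self] at h2
  filter_upwards [h1, h2, hX.condExp_eq_zero (i + 2) h] with ω e1 e2 e3
  exact e1.trans (by simpa [recenter] using congrArg₂ (· - ·) e3 e2)

end Truncation

/-! ### Truncated second moments from the tail bound. -/

section Tail

/-- Over dyadic shells the square grows like `4 ^ k`; a gain of `8 ^ k` in the tail leaves a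
geometric series of ratio `1 / 2`. The bound is `2 ^ (k * p) - 1 ≥ p * k * log 2`. -/
theorem eight_pow_le_exp_rpow_sub {p w : ℝ} (hw : 0 < w) (hpw : 3 ≤ p * w ^ p)
    (k : ℕ) : (8 : ℝ) ^ k ≤ Real.exp ((2 ^ k * w) ^ p - w ^ p) := by
  have h8 : (8 : ℝ) ^ k = Real.exp (3 * (k * Real.log 2)) := by
    have : (8 : ℝ) = 2 ^ 3 := by norm_num
    rw [this, ← pow_mul, ← Real.exp_log (show (0 : ℝ) < 2 ^ (3 * k) by positivity), Real.log_pow]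
    push_cast
    ring_nf
  have h2 : ((2 : ℝ) ^ k) ^ p = Real.exp (p * (k * Real.log 2)) := by
    rw [Real.rpow_def_of_pos (by positivity), Real.log_pow, mul_comm]
  have hk : 0 ≤ k * Real.log 2 := by positivity
  have h3 : p * (k * Real.log 2) + 1 ≤ ((2 : ℝ) ^ k) ^ p := by
    rw [h2]
    exact Real.add_one_le_exp _
  rw [h8, Real.mul_rpow (by positivity) hw.le]
  refine Real.exp_le_exp.2 ?_
  have hwp : 0 ≤ w ^ p := Real.rpow_nonneg hw.le p
  nlinarith [mul_le_mul_of_nonneg_right h3 hwp, mul_le_mul_of_nonneg_right hpw hk]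

variable {Ω : Type*} {m : MeasurableSpace Ω} {μ : Measure Ω} [IsProbabilityMeasure μ]
  {f : Ω → ℝ} {C₁ p : ℝ}

theorem ofReal_sq_indicator_le_tsum {w : ℝ} (hw : 0 < w) (ω : Ω) :
    {ω | w < f ω}.indicator (fun ω => ENNReal.ofReal (f ω ^ 2)) ω ≤
      ∑' k : ℕ, {ω | 2 ^ k * w < f ω}.indicator
        (fun _ => ENNReal.ofReal ((2 ^ (k + 1) * w) ^ 2)) ω := by
  classical
  by_cases h : w < f ω
  swap
  · simp [h]
  obtain ⟨n, hn⟩ := pow_unbounded_of_one_lt (f ω / w) (one_lt_two (α := ℝ))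
  have hex : ∃ n : ℕ, f ω ≤ 2 ^ n * w := ⟨n, ((div_lt_iff₀ hw).1 hn).le⟩
  obtain ⟨k, hk⟩ : ∃ k, Nat.find hex = k + 1 := Nat.exists_eq_succ_of_ne_zero fun h0 => by
    have := Nat.find_spec hex
    rw [h0, pow_zero, one_mul] at this
    exact not_lt.2 this h
  have h1 : f ω ≤ 2 ^ (k + 1) * w := hk ▸ Nat.find_spec hex
  have h2 : 2 ^ k * w < f ω := not_le.1 (Nat.find_min hex (by omega))
  refine le_trans ?_ (ENNReal.le_tsum k)
  rw [Set.indicator_of_mem (show ω ∈ {ω | w < f ω} from h),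
    Set.indicator_of_mem (show ω ∈ {ω | 2 ^ k * w < f ω} from h2)]
  exact ENNReal.ofReal_le_ofReal (pow_le_pow_left₀ (hw.trans h).le h1 2)

theorem measure_lt_le_of_tail
    (htail : ∀ t : ℝ, 0 < t → Real.exp (t ^ p) * μ.real {ω | t < f ω} ≤ C₁) {t : ℝ} (ht : 0 < t) :
    μ {ω | t < f ω} ≤ ENNReal.ofReal (C₁ * Real.exp (-t ^ p)) := by
  rw [← ofReal_measureReal]
  refine ENNReal.ofReal_le_ofReal ?_
  rw [Real.exp_neg, ← div_eq_mul_inv, le_div_iff₀ (Real.exp_pos _), mul_comm]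
  exact htail t ht

theorem lintegral_sq_indicator_le_of_large (hf : Measurable f) (hC₁ : 0 ≤ C₁)
    (htail : ∀ t : ℝ, 0 < t → Real.exp (t ^ p) * μ.real {ω | t < f ω} ≤ C₁) {w : ℝ} (hw : 0 < w)
    (hpw : 3 ≤ p * w ^ p) :
    ∫⁻ ω, {ω | w < f ω}.indicator (fun ω => ENNReal.ofReal (f ω ^ 2)) ω ∂μ ≤
      ENNReal.ofReal (8 * C₁ * w ^ 2 * Real.exp (-w ^ p)) := by
  have hmeas : ∀ t : ℝ, MeasurableSet {ω | t < f ω} := fun t =>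
    measurableSet_lt measurable_const hf
  have hterm : ∀ k : ℕ, ∫⁻ ω, {ω | 2 ^ k * w < f ω}.indicator
      (fun _ => ENNReal.ofReal ((2 ^ (k + 1) * w) ^ 2)) ω ∂μ ≤
      ENNReal.ofReal (4 * C₁ * w ^ 2 * Real.exp (-w ^ p) * (1 / 2) ^ k) := fun k => by
    rw [lintegral_indicator_const (hmeas _)]
    refine (mul_le_mul_right (measure_lt_le_of_tail htail (by positivity)) _).trans ?_
    rw [← ENNReal.ofReal_mul (by positivity)]
    refine ENNReal.ofReal_le_ofReal ?_
    have h := eight_pow_le_exp_rpow_sub hw hpw k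
    have e1 : Real.exp (-(2 ^ k * w) ^ p) * Real.exp ((2 ^ k * w) ^ p - w ^ p) =
        Real.exp (-w ^ p) := by
      rw [← Real.exp_add]; congr 1; ring
    have h1 : Real.exp (-(2 ^ k * w) ^ p) * 8 ^ k ≤ Real.exp (-w ^ p) := by
      rw [← e1]
      exact mul_le_mul_of_nonneg_left h (Real.exp_pos _).le
    have e2 : (8 : ℝ) ^ k = 4 ^ k * 2 ^ k := by rw [← mul_pow]; norm_num
    have e3 : (2 : ℝ) ^ k * (1 / 2) ^ k = 1 := by rw [← mul_pow]; norm_num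
    have e4 : ((2 : ℝ) ^ (k + 1) * w) ^ 2 = 4 * 4 ^ k * w ^ 2 := by
      have : (4 : ℝ) = 2 ^ 2 := by norm_num
      rw [this, ← pow_mul]; ring
    have h2 := mul_le_mul_of_nonneg_left h1
      (show 0 ≤ 4 * C₁ * w ^ 2 * (1 / 2) ^ k by positivity)
    calc ((2 : ℝ) ^ (k + 1) * w) ^ 2 * (C₁ * Real.exp (-(2 ^ k * w) ^ p))
        = 4 * C₁ * w ^ 2 * (1 / 2) ^ k * (Real.exp (-(2 ^ k * w) ^ p) * 8 ^ k) := by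
          rw [e4, e2]
          linear_combination (-4 * C₁ * w ^ 2 * Real.exp (-(2 ^ k * w) ^ p) * 4 ^ k) * e3
      _ ≤ _ := h2.trans_eq (by ring)
  refine (lintegral_mono fun ω => ofReal_sq_indicator_le_tsum hw ω).trans ?_
  rw [lintegral_tsum fun k => (measurable_const.indicator (hmeas _)).aemeasurable]
  refine (ENNReal.tsum_le_tsum hterm).trans_eq ?_
  rw [← ENNReal.ofReal_tsum_of_nonneg (fun k => by positivity)
    (summable_geometric_two.mul_left _), tsum_mul_left, tsum_geometric_two]
  ring_nf

theorem lintegral_sq_indicator_le (hf : Measurable f) (hf0 : ∀ ω, 0 ≤ f ω) (hp : 0 < p)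
    (hC₁ : 0 ≤ C₁)
    (htail : ∀ t : ℝ, 0 < t → Real.exp (t ^ p) * μ.real {ω | t < f ω} ≤ C₁) {w : ℝ} (hw : 0 < w) :
    ∫⁻ ω, {ω | w < f ω}.indicator (fun ω => ENNReal.ofReal (f ω ^ 2)) ω ∂μ ≤
      ENNReal.ofReal (9 * C₁ * (w ^ 2 + ((3 / p) ^ (1 / p)) ^ 2) * Real.exp (-w ^ p)) := by
  -- `b` solves `p * b ^ p = 3`, the threshold of the large case. Between `w` and `max w b` the
  -- square is bounded by a constant, which adds one to the factor `8`.
  set b := (3 / p) ^ (1 / p) with hb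
  have hb0 : 0 < b := by positivity
  have hbp : p * b ^ p = 3 := by
    rw [hb, ← Real.rpow_mul (by positivity), one_div_mul_cancel hp.ne', Real.rpow_one]
    field_simp
  set z := max w b with hz
  have hz0 : 0 < z := lt_max_of_lt_left hw
  have hwz : w ^ p ≤ z ^ p := Real.rpow_le_rpow hw.le (le_max_left _ _) hp.le
  have hpz : 3 ≤ p * z ^ p := by
    rw [← hbp]
    exact mul_le_mul_of_nonneg_left (Real.rpow_le_rpow hb0.le (le_max_right _ _) hp.le) hp.le
  have hz2 : z ^ 2 ≤ w ^ 2 + b ^ 2 := by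
    rcases max_choice w b with h | h <;> rw [hz, h] <;> nlinarith [sq_nonneg w, sq_nonneg b]
  have hpt : ∀ ω, {ω | w < f ω}.indicator (fun ω => ENNReal.ofReal (f ω ^ 2)) ω ≤
      {ω | z < f ω}.indicator (fun ω => ENNReal.ofReal (f ω ^ 2)) ω +
      {ω | w < f ω}.indicator (fun _ => ENNReal.ofReal (z ^ 2)) ω := fun ω => by
    by_cases h1 : w < f ω
    swap
    · simp [h1]
    by_cases h2 : z < f ω
    · simp [h1, h2]
    · simp only [Set.indicator, Set.mem_ofPred_eq, h1, h2, if_true, if_false, zero_add]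
      exact ENNReal.ofReal_le_ofReal (pow_le_pow_left₀ (hf0 ω) (not_lt.1 h2) 2)
  have hmeas : MeasurableSet {ω | w < f ω} := measurableSet_lt measurable_const hf
  refine (lintegral_mono hpt).trans ?_
  rw [lintegral_add_right _ (measurable_const.indicator hmeas), lintegral_indicator_const hmeas]
  refine (add_le_add (lintegral_sq_indicator_le_of_large hf hC₁ htail hz0 hpz)
    (mul_le_mul_right (measure_lt_le_of_tail htail hw) _)).trans ?_
  rw [← ENNReal.ofReal_mul (by positivity), ← ENNReal.ofReal_add (by positivity) (by positivity)]
  refine ENNReal.ofReal_le_ofReal ?_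
  have he : Real.exp (-z ^ p) ≤ Real.exp (-w ^ p) := Real.exp_le_exp.2 (by linarith)
  have h1 := mul_le_mul_of_nonneg_left he (show 0 ≤ 8 * C₁ * z ^ 2 by positivity)
  have h2 := mul_le_mul_of_nonneg_left hz2
    (show 0 ≤ 9 * C₁ * Real.exp (-w ^ p) by positivity)
  linarith

end Tail

/-! ### Assembling the deviation inequality. -/

/-- Chebyshev's inequality for the partial sums of a martingale difference sequence. -/
theorem IsRDSmooth.measureReal_norm_partialSum_le {B : Type u} [NormedAddCommGroup B]
    [NormedSpace ℝ B] [CompleteSpace B] {D : ℝ} (hD : 0 < D) (hB : IsRDSmooth.{u, v} B 2 D)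
    {Ω : Type v} {m : MeasurableSpace Ω} {μ : Measure Ω} [IsProbabilityMeasure μ]
    {ℱ : Filtration ℕ m} {Z : ℕ → Ω → B} (hZ : IsMartingaleDifference μ ℱ Z) {V : ℝ} (hV : 0 ≤ V)
    (hZV : ∀ i, 1 ≤ i → ∫⁻ ω, ‖Z i ω‖ₑ ^ (2 : ℝ) ∂μ ≤ ENNReal.ofReal V) {n : ℕ} (hn : 1 ≤ n)
    {r : ℝ} (hr : 0 < r) :
    μ.real {ω | r < ‖partialSum Z n ω‖} ≤ D * (n * V) / r ^ 2 := by
  have h1 : ∫⁻ ω, ‖partialSum Z n ω‖ₑ ^ (2 : ℝ) ∂μ ≤ ENNReal.ofReal (D * (n * V)) := by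
    refine (hB.2 Ω m μ inferInstance ℱ Z hZ n hn).trans ?_
    rw [ENNReal.ofReal_mul hD.le]
    refine mul_le_mul_right ((Finset.sum_le_sum fun i hi =>
      hZV i (Finset.mem_Icc.1 hi).1).trans_eq ?_) _
    rw [Finset.sum_const, Nat.card_Icc, Nat.add_sub_cancel, nsmul_eq_mul,
      ENNReal.ofReal_mul (by positivity), ENNReal.ofReal_natCast]
  have hS : AEMeasurable (fun ω => ‖partialSum Z n ω‖ₑ ^ (2 : ℝ)) μ :=
    ((stronglyMeasurable_partialSum hZ.stronglyMeasurable n).mono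
      (ℱ.le n)).aestronglyMeasurable.enorm.pow_const _
  have h2 := (mul_meas_ge_le_lintegral₀ hS (ENNReal.ofReal (r ^ 2))).trans h1
  have hsub : {ω | r < ‖partialSum Z n ω‖} ⊆
      {ω | ENNReal.ofReal (r ^ 2) ≤ ‖partialSum Z n ω‖ₑ ^ (2 : ℝ)} := fun ω hω => by
    have hω : r < ‖partialSum Z n ω‖ := hω
    rw [Set.mem_ofPred_eq, ← ofReal_norm,
      ENNReal.ofReal_rpow_of_nonneg (norm_nonneg _) (by norm_num), Real.rpow_ofNat]
    exact ENNReal.ofReal_le_ofReal (pow_le_pow_left₀ hr.le hω.le 2)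
  have h3 := (mul_le_mul_right (measure_mono (μ := μ) hsub) (ENNReal.ofReal (r ^ 2))).trans h2
  rw [← ofReal_measureReal, ← ENNReal.ofReal_mul (by positivity),
    ENNReal.ofReal_le_ofReal_iff (by positivity)] at h3
  rwa [le_div_iff₀ (by positivity), mul_comm]

theorem IsRDSmooth.one_le {B : Type u} [NormedAddCommGroup B] [NormedSpace ℝ B]
    [CompleteSpace B] [TopologicalSpace.SeparableSpace B] [Nontrivial B] {D : ℝ} (hD : 0 < D)
    (hB : IsRDSmooth.{u, v} B 2 D) : 1 ≤ D := by
  obtain ⟨x, hx⟩ := exists_ne (0 : B)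
  have h := hB.dyadicValue_le hD (k := 0) (x := x) rfl
  have hx' : 0 < ‖x‖ ^ 2 := by positivity
  exact le_of_mul_le_mul_right (by rwa [one_mul]) hx'

/-- The deviation inequality for `‖S n‖`, with a free truncation level `w`. -/
theorem IsRDSmooth.measureReal_lt_norm_partialSum_le {B : Type u} [NormedAddCommGroup B]
    [NormedSpace ℝ B] [CompleteSpace B] [TopologicalSpace.SeparableSpace B] {D : ℝ} (hD : 1 ≤ D)
    (hB : IsRDSmooth.{u, v} B 2 D) {Ω : Type v} {m : MeasurableSpace Ω} {μ : Measure Ω}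
    [IsProbabilityMeasure μ] {ℱ : Filtration ℕ m} {X : ℕ → Ω → B}
    (hX : IsMartingaleDifference μ ℱ X) {p C₁ : ℝ} (hp : 0 < p)
    (htail : ∀ i : ℕ, 1 ≤ i → ∀ t : ℝ, 0 < t →
      Real.exp (t ^ p) * μ.real {ω | t < ‖X i ω‖} ≤ C₁) (hC₁ : 0 ≤ C₁)
    {x : ℝ} (hx : 0 < x) {n : ℕ} (hn : 1 ≤ n) {w : ℝ} (hw : 0 < w) :
    μ.real {ω | n * x < ‖partialSum X n ω‖} ≤
      2 * Real.exp (-(n * x ^ 2 / (16 * D ^ 2 * w ^ 2))) +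
        576 * D * C₁ * (w ^ 2 + ((3 / p) ^ (1 / p)) ^ 2) / (n * x ^ 2) * Real.exp (-w ^ p) := by
  have hD0 : 0 < D := one_pos.trans_le hD
  have hn0 : (0 : ℝ) < n := by exact_mod_cast hn
  set Y := recenter μ ℱ (truncated X w)
  set Z : ℕ → Ω → B := fun i => X i - Y i with hZdef
  have hsum : ∀ ω, partialSum X n ω = partialSum Y n ω + partialSum Z n ω := fun ω => by
    simp only [partialSum, ← Finset.sum_add_distrib, hZdef, Pi.sub_apply, add_sub_cancel]
  -- With three quarters of the deviation for the bounded part, `l = x / (4 * D * w ^ 2)` gives the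
  -- exponent `2 / 16 - 3 / 16 = -1 / 16` in units of `n * x ^ 2 / (D * w ^ 2)`. The remaining
  -- quarter costs a factor `16` in Chebyshev: `576 = 16 * 4 * 9`.
  have hsub : {ω | n * x < ‖partialSum X n ω‖} ⊆
      {ω | 3 / 4 * (n * x) < ‖partialSum Y n ω‖} ∪ {ω | 1 / 4 * (n * x) < ‖partialSum Z n ω‖} := by
    intro ω hω
    have hω : n * x < ‖partialSum X n ω‖ := hω
    by_contra h
    simp only [Set.mem_union, Set.mem_ofPred_eq, not_or, not_lt] at h
    have := norm_add_le (partialSum Y n ω) (partialSum Z n ω)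
    rw [← hsum] at this
    linarith [h.1, h.2]
  refine (measureReal_mono hsub).trans ((measureReal_union_le _ _).trans (add_le_add ?_ ?_))
  · refine (hB.measureReal_norm_partialSum_recenter_le hD0 hw.le
      (hX.stronglyMeasurable_truncated w) (norm_truncated_le X hw.le)
      (l := x / (4 * D * w ^ 2)) (by positivity) _ n).trans ?_
    refine mul_le_mul_of_nonneg_left (Real.exp_le_exp.2 ?_) (by norm_num)
    have e : 2 * n * D * (x / (4 * D * w ^ 2)) ^ 2 * w ^ 2 -
        x / (4 * D * w ^ 2) * (3 / 4 * (n * x)) = -(n * x ^ 2 / (16 * D * w ^ 2)) := by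
      field_simp
      ring
    rw [e, neg_le_neg_iff]
    -- Replacing `D` by `D ^ 2` weakens the bound to the form of the final exponent; this uses `1 ≤
    -- D`.
    have : D * 1 ≤ D * D := mul_le_mul_of_nonneg_left hD hD0.le
    gcongr
    linarith
  · have hV : ∀ i, 1 ≤ i → ∫⁻ ω, ‖Z i ω‖ₑ ^ (2 : ℝ) ∂μ ≤ ENNReal.ofReal
        (36 * C₁ * (w ^ 2 + ((3 / p) ^ (1 / p)) ^ 2) * Real.exp (-w ^ p)) := fun i hi => by
      refine (hX.lintegral_sub_recenter_truncated_le hw.le hi).trans ?_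
      have hXm := ((hX.stronglyMeasurable i hi).mono (ℱ.le i)).norm.measurable
      have h := lintegral_sq_indicator_le (μ := μ) hXm (fun ω => norm_nonneg _) hp hC₁
        (htail i hi) hw
      refine (mul_le_mul_right (le_trans (le_of_eq (lintegral_congr fun ω => ?_)) h) 4).trans_eq ?_
      · by_cases h1 : ‖X i ω‖ ≤ w
        · simp [exceeding, h1, not_lt.2 h1]
        · simp [exceeding, h1, not_le.1 h1]
      · rw [← ENNReal.ofReal_ofNat, ← ENNReal.ofReal_mul (by norm_num)]
        ring_nf
    refine (hB.measureReal_norm_partialSum_le hD0 (hX.sub_recenter_truncated w) (by positivity)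
      hV hn (by positivity)).trans (le_of_eq ?_)
    field_simp
    ring

theorem deviationConst_nonneg {D C₁ α x : ℝ} (hD : 0 < D) (hC₁ : 0 ≤ C₁) (hα0 : 0 < α)
    (hα1 : α < 1) (hx : 0 < x) : 0 ≤ deviationConst D C₁ α x := by
  have : 0 < 1 - α := by linarith
  unfold deviationConst
  positivity

theorem IsRDSmooth.measureReal_lt_maxNormPartialSum_le {B : Type u} [NormedAddCommGroup B]
    [NormedSpace ℝ B] [CompleteSpace B] [TopologicalSpace.SeparableSpace B] {D : ℝ} (hD : 0 < D)
    (hB : IsRDSmooth.{u, v} B 2 D) {Ω : Type v} {m : MeasurableSpace Ω} {μ : Measure Ω}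
    [IsProbabilityMeasure μ] {ℱ : Filtration ℕ m} {X : ℕ → Ω → B}
    (hX : IsMartingaleDifference μ ℱ X) {α : ℝ} (hα0 : 0 < α) (hα1 : α < 1) {C₁ : ℝ}
    (htail : ∀ i : ℕ, 1 ≤ i → ∀ t : ℝ, 0 < t →
      Real.exp (t ^ (2 * α / (1 - α))) * μ.real {ω | t < ‖X i ω‖} ≤ C₁)
    {x : ℝ} (hx : 0 < x) {n : ℕ} (hn : 1 ≤ n) :
    μ.real {ω | n * x < maxNormPartialSum X n ω} ≤
      deviationConst D C₁ α x * Real.exp (-((x / (4 * D)) ^ (2 * α) * (n : ℝ) ^ α)) := by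
  have hC₁ : 0 ≤ C₁ := le_trans (by positivity) (htail 1 le_rfl 1 one_pos)
  have hα : 0 < 1 - α := by linarith
  have hn0 : (0 : ℝ) < n := by exact_mod_cast hn
  -- `1 ≤ D` is derived from a nonzero vector, so the zero space is treated apart.
  rcases subsingleton_or_nontrivial B with hs | hs
  · have : {ω | n * x < maxNormPartialSum X n ω} = ∅ := by
      ext ω
      simp only [Set.mem_ofPred_eq, Set.mem_empty_iff_false, iff_false,
        lt_maxNormPartialSum_iff (by positivity : 0 ≤ n * x), not_exists, not_and, not_lt]
      intro k _
      rw [Subsingleton.elim (partialSum X k ω) 0, norm_zero]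
      positivity
    rw [this, measureReal_empty]
    exact mul_nonneg (deviationConst_nonneg hD hC₁ hα0 hα1 hx) (Real.exp_pos _).le
  have hD1 : 1 ≤ D := hB.one_le hD
  set p := 2 * α / (1 - α) with hp
  have hp0 : 0 < p := by positivity
  -- This level balances the two exponents: `w ^ p` and `n * x ^ 2 / (16 * D ^ 2 * w ^ 2)` both
  -- equal `E`.
  set w := (√n * x / (4 * D)) ^ (1 - α) with hw
  have hb0 : 0 < √n * x / (4 * D) := by positivity
  have hw0 : 0 < w := Real.rpow_pos_of_pos hb0 _
  set E := (x / (4 * D)) ^ (2 * α) * (n : ℝ) ^ α with hE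
  have hsq : (√n * x / (4 * D)) ^ (2 * α) = E := by
    rw [hE, mul_div_assoc, mul_comm, Real.mul_rpow (by positivity) (by positivity),
      Real.sqrt_eq_rpow, ← Real.rpow_mul hn0.le]
    congr 2
    ring
  have hwp : w ^ p = E := by
    rw [← hsq, hw, ← Real.rpow_mul hb0.le, hp]
    congr 1
    field_simp
  have hw2 : w ^ 2 * E = n * x ^ 2 / (16 * D ^ 2) := by
    rw [← hsq, hw, ← Real.rpow_mul_natCast hb0.le, ← Real.rpow_add hb0]
    have : (1 - α) * (2 : ℕ) + 2 * α = (2 : ℕ) := by push_cast; ring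
    rw [this, Real.rpow_natCast, div_pow, mul_pow, Real.sq_sqrt hn0.le]
    ring
  have hE0 : 0 < E := by positivity
  have hexp1 : n * x ^ 2 / (16 * D ^ 2 * w ^ 2) = E := by
    rw [← div_div, ← hw2]
    field_simp
  have hmain := hB.measureReal_lt_norm_partialSum_le hD1 (hX.stoppedDifference (n * x)) hp0
    (fun i hi t ht => (mul_le_mul_of_nonneg_left (measureReal_mono fun ω hω =>
      lt_of_lt_of_le (show t < _ from hω) (norm_stoppedDifference_le X (n * x) i ω))
        (Real.exp_pos _).le).trans (htail i hi t ht)) hC₁ hx hn hw0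
  have hsub : {ω | n * x < maxNormPartialSum X n ω} ⊆
      {ω | n * x < ‖partialSum (stoppedDifference X (n * x)) n ω‖} := fun ω hω => by
    obtain ⟨k, hk, h⟩ := (lt_maxNormPartialSum_iff (by positivity)).1 hω
    exact lt_norm_partialSum_stoppedDifference (Finset.mem_Icc.1 hk).2 h
  refine ((measureReal_mono hsub).trans hmain).trans ?_
  rw [hexp1, hwp, ← add_mul]
  refine mul_le_mul_of_nonneg_right ?_ (Real.exp_pos _).le
  have hβ : ((3 / p) ^ (1 / p)) ^ 2 = (3 * (1 - α) / (2 * α)) ^ ((1 - α) / α) := by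
    rw [← Real.rpow_mul_natCast (by positivity), hp]
    congr 1 <;> field_simp
    norm_num
  set b := (3 * (1 - α) / (2 * α)) ^ ((1 - α) / α) with hbdef
  have hb : 0 ≤ b := by positivity
  set A := x ^ (2 * α) * (16 : ℝ) ^ (1 - α) * D ^ (2 * (1 - α)) with hA
  have hA0 : 0 < A := by positivity
  have hwA : w ^ 2 / (n * x ^ 2) ≤ 1 / A := by
    have e1 : w ^ 2 / (n * x ^ 2) = 1 / (16 * D ^ 2 * E) := by
      rw [div_eq_div_iff (by positivity) (by positivity)]
      rw [eq_div_iff (by positivity)] at hw2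
      linarith
    have e2 : 16 * D ^ 2 * E = A * n ^ α := by
      have d1 : D ^ (2 * (1 - α)) * D ^ (2 * α) = D ^ 2 := by
        rw [← Real.rpow_add hD, ← Real.rpow_natCast]; congr 1; push_cast; ring
      have d2 : (16 : ℝ) ^ (1 - α) * (4 : ℝ) ^ (2 * α) = 16 := by
        rw [Real.rpow_mul (by norm_num : (0 : ℝ) ≤ 4), Real.rpow_ofNat,
          show (4 : ℝ) ^ 2 = 16 by norm_num, ← Real.rpow_add (by norm_num), sub_add_cancel,
          Real.rpow_one]
      rw [hE, hA, Real.div_rpow hx.le (by positivity), Real.mul_rpow (by norm_num) hD.le]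
      have : (4 : ℝ) ^ (2 * α) ≠ 0 := by positivity
      have : D ^ (2 * α) ≠ 0 := by positivity
      field_simp
      linear_combination (-16 : ℝ) * d1 - D ^ (2 * (1 - α)) * D ^ (2 * α) * d2
    rw [e1, e2]
    have h1 : (1 : ℝ) ≤ (n : ℝ) ^ α := Real.one_le_rpow (by exact_mod_cast hn) hα0.le
    exact one_div_le_one_div_of_le hA0 (le_mul_of_one_le_right hA0.le h1)
  have hbn : b / (n * x ^ 2) ≤ 1 / x ^ 2 * b := by
    rw [one_div_mul_eq_div]
    have : (1 : ℝ) ≤ n := by exact_mod_cast hn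
    exact div_le_div_of_nonneg_left hb (by positivity)
      (le_mul_of_one_le_left (by positivity) this)
  -- The constant obtained is far smaller than the one claimed.
  have hconst : 576 * D * C₁ ≤ 1007156 * Real.exp 1 ^ 2 * D ^ 2 * C₁ := by
    refine mul_le_mul_of_nonneg_right ?_ hC₁
    have h1 : 1 ≤ Real.exp 1 ^ 2 := one_le_pow₀ (Real.one_le_exp zero_le_one)
    have h2 : D ≤ D ^ 2 := by nlinarith
    have h3 : D ^ 2 ≤ Real.exp 1 ^ 2 * D ^ 2 := le_mul_of_one_le_left (by positivity) h1
    linarith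
  rw [hβ, deviationConst, mul_div_assoc, add_div]
  exact add_le_add_right (mul_le_mul hconst (add_le_add hwA hbn) (by positivity)
    (by positivity)) 2

theorem theorem1 {B : Type u} [NormedAddCommGroup B] [NormedSpace ℝ B] [CompleteSpace B]
    [TopologicalSpace.SeparableSpace B] {D : ℝ} (hD : 0 < D) (hB : IsRDSmooth.{u, v} B 2 D)
    {Ω : Type v} {m : MeasurableSpace Ω} (μ : Measure Ω) [IsProbabilityMeasure μ]
    (ℱ : Filtration ℕ m) (X : ℕ → Ω → B) (hX : IsMartingaleDifference μ ℱ X)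
    {α : ℝ} (hα0 : 0 < α) (hα1 : α < 1) (C₁ : ℝ)
    (htail : ∀ i : ℕ, 1 ≤ i → ∀ t : ℝ, 0 < t →
      Real.exp (t ^ (2 * α / (1 - α))) * μ.real {ω | t < ‖X i ω‖} ≤ C₁) :
    (∀ x : ℝ, 0 < x → ∀ n : ℕ, 1 ≤ n →
      μ.real {ω | n * x < maxNormPartialSum X n ω}
        ≤ deviationConst D C₁ α x * Real.exp (-((x / (4 * D)) ^ (2 * α) * (n : ℝ) ^ α))) ∧
    (fun n : ℕ => μ.real {ω | (n : ℝ) < maxNormPartialSum X n ω})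
      =O[atTop] fun n : ℕ => Real.exp (-(1 / (4 * D) ^ (2 * α) * (n : ℝ) ^ α)) := by
  have h := fun (x : ℝ) (hx : 0 < x) (n : ℕ) (hn : 1 ≤ n) =>
    hB.measureReal_lt_maxNormPartialSum_le hD hX hα0 hα1 htail hx hn
  refine ⟨h, IsBigO.of_bound (deviationConst D C₁ α 1) ?_⟩
  filter_upwards [eventually_ge_atTop 1] with n hn
  have h1 := h 1 one_pos n hn
  rw [mul_one, Real.div_rpow zero_le_one (by positivity), Real.one_rpow] at h1
  rwa [Real.norm_of_nonneg measureReal_nonneg, Real.norm_of_nonneg (Real.exp_pos _).le]
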